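/- A \emph{coherent configuration} on a finite set $\Omega$ is a pair $\mathcal X=(\Omega,S)$, where $S$ is a partition of $\Omega\times\Omega$ (into \emph{basis relations}) such that the diagonal $1_\Omega$ is a union of elements of $S$, $s^*=\{(\beta,\alpha):(\alpha,\beta)\in s\}\in S$ for all $s\in S$, and for all $r,s,t\in S$ the \emph{intersection number} $c_{rs}^t=|\{\gamma:(\alpha,\gamma)\in r,\ (\gamma,\beta)\in s\}|$ does not depend on the choice of $(\alpha,\beta)\in t$. An \emph{algebraic isomorphism} from $\mathcal X$ to $\mathcal X'=(\Omega',S')$ is a bijection $\varphi:S\to S'$ preserving the intersection numbers; it extends to unions of basis relations. It is \emph{induced by an isomorphism} if there is a bijection $f:\Omega\to\Omega'$ with $\varphi(s)=s^f$ for all $s\in S$. For $m\ge 1$, the \emph{$m$-extension} of $\mathcal X$ is the smallest (i.e. coarsest) coherent configuration on $\Omega^m$ for which all relations $s_1\otimes\cdots\otimes s_m=\{(\alpha,\beta):(\alpha_i,\beta_i)\in s_i\text{ for all }i\}$ with $s_i\in S$, and the relation $1_{\mathrm{Diag}(\Omega^m)}=\{((a,\dots,a),(a,\dots,a)):a\in\Omega\}$,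 are unions of basis relations; its intersection numbers are the \emph{$m$-dimensional intersection numbers} of $\mathcal X$. An algebraic isomorphism $\varphi$ from $\mathcal X$ to $\mathcal X'$ is \emph{$m$-dimensional} if there is an algebraic isomorphism $\psi$ between the $m$-extensions with $\psi(s_1\otimes\cdots\otimes s_m)=\varphi(s_1)\otimes\cdots\otimes\varphi(s_m)$ for all $s_i\in S$ and $\psi(1_{\mathrm{Diag}(\Omega^m)})=1_{\mathrm{Diag}(\Omega'^m)}$. The \emph{separability number} $s(\mathcal X)$ is the smallest positive integer $m$ such that every $m$-dimensional algebraic isomorphism from $\mathcal X$ to a coherent configuration is induced by an isomorphism. Let $d\ge 3$ be a prime and $q=2^d$. The \emph{small Hollmann scheme} of degree $q(q-1)/2$ is the coherent configuration whose basis relations are the orbits on $\Omega\times\Omega$ of the group $\mathrm{P\Gamma L}(2,q)$ in its action on the set $\Omega$ of the $q(q-1)/2$ anisotropic binary quadratic forms over $\mathbb F_q$ up to nonzero scalars (a semilinear bijection $f$ of $\mathbb F_q^2$ with field automorphism $\sigma$ takes the class of $Q$ to the class of $\sigma\circ Q\circ f^{-1}$); equivalently, in its action on the pairs of conjugate points of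 $\mathrm{PG}(1,q^2)\setminus\mathrm{PG}(1,q)$. \textbf{Theorem.} Let $\mathcal X$ be the small Hollmann scheme of degree $q(q-1)/2$, where $q=2^d$ with $d\ge 3$ prime and $d\ne 7,11,13$. Then $s(\mathcal X)\le 3$; moreover, every $3$-dimensional algebraic isomorphism from $\mathcal X$ to a coherent configuration is induced by an isomorphism, i.e. $\mathcal X$ is determined up to isomorphism by its $3$-dimensional intersection numbers. -/

import Mathlib

open scoped LinearAlgebra.Projectivization

/-- The converse relation `r* = {(β, α) : (α, β) ∈ r}`. -/
def converseRel {Ω : Type*} (r : Set (Ω × Ω)) : Set (Ω × Ω) := {p | (p.2, p.1) ∈ r}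

/-- For relations `r, s` and a pair `p = (α, β)`, the number `|α r ∩ β s*|` of points `γ` with
`(α, γ) ∈ r` and `(γ, β) ∈ s`. -/
noncomputable def pathCount {Ω : Type*} (r s : Set (Ω × Ω)) (p : Ω × Ω) : ℕ :=
  {γ : Ω | (p.1, γ) ∈ r ∧ (γ, p.2) ∈ s}.ncard

/-- A coherent configuration on `Ω`, given by its set `S` of basis relations. -/
structure CoherentConfiguration (Ω : Type*) where
  /-- the basis relations -/
  S : Set (Set (Ω × Ω))
  isPartition : Setoid.IsPartition S
  /-- the diagonal is a union of basis relations -/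
  diagonal_union : ∃ T ⊆ S, Set.diagonal Ω = ⋃₀ T
  /-- `S* = S` -/
  converse_eq : converseRel '' S = S
  /-- `|α r ∩ β s*|` does not depend on the choice of `(α, β) ∈ t` -/
  coherent : ∀ r ∈ S, ∀ s ∈ S, ∀ t ∈ S, ∀ p ∈ t, ∀ p' ∈ t, pathCount r s p = pathCount r s p'

namespace CoherentConfiguration

variable {Ω Ω' : Type*}

/-- `S^∪`: the relations of `X`, that is, the unions of basis relations. -/
def relations (X : CoherentConfiguration Ω) : Set (Set (Ω × Ω)) := {R | ∃ T ⊆ X.S, R = ⋃₀ T}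

/-- The partial order: `X ≤ Y` if every relation of `X` is a relation of `Y`. -/
instance : LE (CoherentConfiguration Ω) := ⟨fun X Y => X.relations ⊆ Y.relations⟩

theorem nonempty_of_mem (X : CoherentConfiguration Ω) {t : Set (Ω × Ω)} (ht : t ∈ X.S) :
    t.Nonempty :=
  Setoid.nonempty_of_mem_partition X.isPartition ht

/-- The intersection number `c_{rs}^t`. -/
noncomputable def intersectionNumber (X : CoherentConfiguration Ω) (r s t : X.S) : ℕ :=
  pathCount r.1 s.1 (X.nonempty_of_mem t.2).some

theorem pathCount_eq_intersectionNumber (X : CoherentConfiguration Ω) (r s t : X.S)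
    {p : Ω × Ω} (hp : p ∈ t.1) : pathCount r.1 s.1 p = X.intersectionNumber r s t :=
  X.coherent _ r.2 _ s.2 _ t.2 _ hp _ (X.nonempty_of_mem t.2).some_mem

/-! ### The coherent closure -/

theorem exists_mem (X : CoherentConfiguration Ω) (p : Ω × Ω) : ∃ s ∈ X.S, p ∈ s := by
  obtain ⟨s, hs, -⟩ := X.isPartition.2 p
  exact ⟨s, hs.1, hs.2⟩

theorem eq_of_mem (X : CoherentConfiguration Ω) {p : Ω × Ω} {s t : Set (Ω × Ω)}
    (hs : s ∈ X.S) (ht : t ∈ X.S) (hps : p ∈ s) (hpt : p ∈ t) : s = t :=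
  (X.isPartition.2 p).unique ⟨hs, hps⟩ ⟨ht, hpt⟩

/-- The equivalence relation on `Ω × Ω` whose classes are the basis relations. -/
def toSetoid (X : CoherentConfiguration Ω) : Setoid (Ω × Ω) where
  r p p' := ∃ s ∈ X.S, p ∈ s ∧ p' ∈ s
  iseqv :=
    { refl := fun p => by
        obtain ⟨s, hs, hp⟩ := X.exists_mem p
        exact ⟨s, hs, hp, hp⟩
      symm := by
        rintro p p' ⟨s, hs, hp, hp'⟩
        exact ⟨s, hs, hp', hp⟩
      trans := by
        rintro p p' p'' ⟨s, hs, hp, hp'⟩ ⟨t, ht, hq, hq'⟩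
        exact ⟨s, hs, hp, X.eq_of_mem ht hs hq hp' ▸ hq'⟩ }

theorem toSetoid_iff (X : CoherentConfiguration Ω) {p p' : Ω × Ω} :
    X.toSetoid p p' ↔ ∃ s ∈ X.S, p ∈ s ∧ p' ∈ s := Iff.rfl

/-- A set of pairs is a relation of `X` if and only if it is saturated for `X.toSetoid`. -/
theorem mem_relations_iff (X : CoherentConfiguration Ω) {R : Set (Ω × Ω)} :
    R ∈ X.relations ↔ ∀ p p', X.toSetoid p p' → p ∈ R → p' ∈ R := by
  constructor
  · rintro ⟨T, hT, rfl⟩ p p' h ⟨t, ht, hp⟩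
    obtain ⟨s, hs, hps, hps'⟩ := X.toSetoid_iff.1 h
    exact ⟨t, ht, X.eq_of_mem hs (hT ht) hps hp ▸ hps'⟩
  · intro h
    refine ⟨{s | s ∈ X.S ∧ s ⊆ R}, fun s hs => hs.1, ?_⟩
    ext p
    constructor
    · intro hp
      obtain ⟨s, hs, hps⟩ := X.exists_mem p
      exact ⟨s, ⟨hs, fun p' hp' => h p p' (X.toSetoid_iff.2 ⟨s, hs, hps, hp'⟩) hp⟩, hps⟩
    · rintro ⟨s, hs, hps⟩
      exact hs.2 hps

theorem converse_mem (X : CoherentConfiguration Ω) {s : Set (Ω × Ω)} (hs : s ∈ X.S) :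
    converseRel s ∈ X.S := by
  have h := Set.mem_image_of_mem converseRel hs
  rwa [X.converse_eq] at h

theorem diagonal_mem_relations (X : CoherentConfiguration Ω) :
    Set.diagonal Ω ∈ X.relations := X.diagonal_union

open Classical in
/-- The number of paths through two arbitrary relations of `X` depends only on the basis relation
containing the pair of end points. -/
theorem pathCount_congr [Finite Ω] (X : CoherentConfiguration Ω) {R R' : Set (Ω × Ω)}
    (hR : R ∈ X.relations) (hR' : R' ∈ X.relations) {p p' : Ω × Ω} (h : X.toSetoid p p') :
    pathCount R R' p = pathCount R R' p' := by
  have := Fintype.ofFinite Ω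
  have := Fintype.ofFinite X.S
  have key : ∀ x : Ω × Ω, pathCount R R' x =
      ∑ rs : X.S × X.S, if rs.1.1 ⊆ R ∧ rs.2.1 ⊆ R' then pathCount rs.1.1 rs.2.1 x else 0 := by
    intro x
    have h1 : ∀ A B : Set (Ω × Ω), pathCount A B x =
        ∑ γ : Ω, if (x.1, γ) ∈ A ∧ (γ, x.2) ∈ B then 1 else 0 := by
      intro A B
      rw [pathCount, Set.ncard_eq_toFinset_card', Finset.sum_boole]
      simp
    simp only [h1]
    have h2 : ∀ rs : X.S × X.S, (if rs.1.1 ⊆ R ∧ rs.2.1 ⊆ R' then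
        ∑ γ : Ω, (if (x.1, γ) ∈ rs.1.1 ∧ (γ, x.2) ∈ rs.2.1 then 1 else 0) else 0) =
        ∑ γ : Ω, (if (rs.1.1 ⊆ R ∧ rs.2.1 ⊆ R') ∧
          (x.1, γ) ∈ rs.1.1 ∧ (γ, x.2) ∈ rs.2.1 then 1 else 0) := by
      intro rs
      by_cases hc : rs.1.1 ⊆ R ∧ rs.2.1 ⊆ R' <;> simp [hc]
    simp only [h2]
    rw [Finset.sum_comm]
    refine Finset.sum_congr rfl fun γ _ => ?_
    obtain ⟨a, ha, hxa⟩ := X.exists_mem (x.1, γ)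
    obtain ⟨b, hb, hxb⟩ := X.exists_mem (γ, x.2)
    rw [Finset.sum_eq_single (⟨a, ha⟩, ⟨b, hb⟩)]
    · congr 1
      apply propext
      constructor
      · rintro ⟨hA, hB⟩
        refine ⟨⟨fun y hy => ?_, fun y hy => ?_⟩, hxa, hxb⟩
        · exact X.mem_relations_iff.1 hR _ _ (X.toSetoid_iff.2 ⟨a, ha, hxa, hy⟩) hA
        · exact X.mem_relations_iff.1 hR' _ _ (X.toSetoid_iff.2 ⟨b, hb, hxb, hy⟩) hB
      · rintro ⟨⟨hA, hB⟩, -, -⟩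
        exact ⟨hA hxa, hB hxb⟩
    · rintro ⟨⟨a', ha'⟩, ⟨b', hb'⟩⟩ - hne
      rw [if_neg]
      rintro ⟨-, h3, h4⟩
      apply hne
      simp only [Prod.mk.injEq, Subtype.mk.injEq]
      exact ⟨X.eq_of_mem ha' ha h3 hxa, X.eq_of_mem hb' hb h4 hxb⟩
    · simp
  rw [key, key]
  refine Finset.sum_congr rfl fun rs _ => ?_
  obtain ⟨t, ht, hp, hp'⟩ := X.toSetoid_iff.1 h
  rw [X.coherent _ rs.1.2 _ rs.2.2 _ ht _ hp _ hp']

/-- The finest partition of `Ω × Ω` that is coarser than the partitions of all coherent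
configurations having every element of `T` as a relation. -/
def closureSetoid (T : Set (Set (Ω × Ω))) : Setoid (Ω × Ω) :=
  sSup {e | ∃ Y : CoherentConfiguration Ω, T ⊆ Y.relations ∧ Y.toSetoid = e}

theorem toSetoid_le_closureSetoid {T : Set (Set (Ω × Ω))} (Y : CoherentConfiguration Ω)
    (hY : T ⊆ Y.relations) : Y.toSetoid ≤ closureSetoid T :=
  le_sSup ⟨Y, hY, rfl⟩

/-- Every property of pairs that is invariant for all these configurations is invariant for the
closure. -/
theorem closureSetoid_induction {T : Set (Set (Ω × Ω))} {β : Type*} (F : Ω × Ω → β)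
    (hF : ∀ Y : CoherentConfiguration Ω, T ⊆ Y.relations →
      ∀ p p', Y.toSetoid p p' → F p = F p')
    {p p' : Ω × Ω} (h : closureSetoid T p p') : F p = F p' := by
  have : closureSetoid T ≤ Setoid.ker F := by
    apply sSup_le
    rintro _ ⟨Y, hY, rfl⟩ p p' hp
    exact hF Y hY p p' hp
  exact this h

theorem class_mem_relations {T : Set (Set (Ω × Ω))} (Y : CoherentConfiguration Ω)
    (hY : T ⊆ Y.relations) {r : Set (Ω × Ω)} (hr : r ∈ (closureSetoid T).classes) :
    r ∈ Y.relations := by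
  obtain ⟨x, rfl⟩ := hr
  rw [mem_relations_iff]
  intro p p' h hp
  exact (closureSetoid T).trans
    ((closureSetoid T).symm (toSetoid_le_closureSetoid Y hY h)) hp

/-- The coherent closure `WL(T)`: the smallest coherent configuration on `Ω` for which all
elements of `T` are relations (see `WL_isLeast`). -/
def WL [Finite Ω] (T : Set (Set (Ω × Ω))) : CoherentConfiguration Ω where
  S := (closureSetoid T).classes
  isPartition := Setoid.isPartition_classes _
  diagonal_union := by
    refine ⟨{s | s ∈ (closureSetoid T).classes ∧ s ⊆ Set.diagonal Ω}, fun s hs => hs.1, ?_⟩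
    ext p
    constructor
    · intro hp
      refine ⟨{x | closureSetoid T x p}, ⟨⟨p, rfl⟩, fun x hx => ?_⟩, (closureSetoid T).refl p⟩
      have := closureSetoid_induction (T := T) (fun y => y ∈ Set.diagonal Ω)
        (fun Y _ a b hab => propext
          ⟨Y.mem_relations_iff.1 Y.diagonal_mem_relations a b hab,
            Y.mem_relations_iff.1 Y.diagonal_mem_relations b a (Y.toSetoid.symm hab)⟩) hx
      exact this.mpr hp
    · rintro ⟨s, hs, hp⟩
      exact hs.2 hp
  converse_eq := by
    have hswap : ∀ p p' : Ω × Ω, closureSetoid T p p' → closureSetoid T p.swap p'.swap := by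
      intro p p' h
      have := closureSetoid_induction (T := T)
        (fun y => (Quotient.mk (closureSetoid T) y.swap : Quotient (closureSetoid T)))
        (fun Y hY a b hab => Quotient.sound (s := closureSetoid T) (by
          obtain ⟨s, hs, ha, hb⟩ := Y.toSetoid_iff.1 hab
          exact toSetoid_le_closureSetoid Y hY
            (Y.toSetoid_iff.2 ⟨converseRel s, Y.converse_mem hs, ha, hb⟩))) h
      exact Quotient.exact (s := closureSetoid T) this
    have hconv : ∀ x : Ω × Ω, converseRel {y | closureSetoid T y x} =
        {y | closureSetoid T y x.swap} := by
      intro x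
      ext y
      constructor
      · intro h
        simpa using hswap _ _ h
      · intro h
        have h' := hswap _ _ h
        rw [Prod.swap_swap] at h'
        exact h'
    ext s
    constructor
    · rintro ⟨_, ⟨x, rfl⟩, rfl⟩
      exact ⟨x.swap, hconv x⟩
    · rintro ⟨x, rfl⟩
      exact ⟨_, ⟨x.swap, rfl⟩, by rw [hconv]; simp⟩
  coherent := by
    intro r hr s hs t ht p hp p' hp'
    obtain ⟨x, rfl⟩ := ht
    exact closureSetoid_induction (T := T) (pathCount r s)
      (fun Y hY a b hab => Y.pathCount_congr (class_mem_relations Y hY hr)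
        (class_mem_relations Y hY hs) hab) ((closureSetoid T).trans hp ((closureSetoid T).symm hp'))

theorem WL_isLeast [Finite Ω] (T : Set (Set (Ω × Ω))) :
    T ⊆ (WL T).relations ∧ ∀ Y : CoherentConfiguration Ω, T ⊆ Y.relations → WL T ≤ Y := by
  constructor
  · intro R hR
    refine ⟨{s | s ∈ (closureSetoid T).classes ∧ s ⊆ R}, fun s hs => hs.1, ?_⟩
    ext p
    constructor
    · intro hp
      refine ⟨{x | closureSetoid T x p}, ⟨⟨p, rfl⟩, fun x hx => ?_⟩, (closureSetoid T).refl p⟩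
      have := closureSetoid_induction (T := T) (fun y => y ∈ R)
        (fun Y hY a b hab => propext ⟨Y.mem_relations_iff.1 (hY hR) a b hab,
            Y.mem_relations_iff.1 (hY hR) b a (Y.toSetoid.symm hab)⟩) hx
      exact this.mpr hp
    · rintro ⟨s, hs, hp⟩
      exact hs.2 hp
  · rintro Y hY _ ⟨U, hU, rfl⟩
    rw [mem_relations_iff]
    rintro p p' h ⟨u, hu, hp⟩
    exact ⟨u, hu, Y.mem_relations_iff.1 (class_mem_relations Y hY (hU hu)) p p' h hp⟩

/-! ### Algebraic isomorphisms and the separability number -/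

/-- An algebraic isomorphism from `X` to `X'`: a bijection between the basis relations that
preserves the intersection numbers. -/
structure AlgIso (X : CoherentConfiguration Ω) (X' : CoherentConfiguration Ω') where
  toEquiv : X.S ≃ X'.S
  map_intersectionNumber : ∀ r s t : X.S,
    X.intersectionNumber r s t = X'.intersectionNumber (toEquiv r) (toEquiv s) (toEquiv t)

/-- The induced map `S^∪ → (S')^∪`: a union of basis relations goes to the union of their
images. -/
def AlgIso.mapRel {X : CoherentConfiguration Ω} {X' : CoherentConfiguration Ω'}
    (φ : AlgIso X X') (R : Set (Ω × Ω)) : Set (Ω' × Ω') :=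
  {p | ∃ s : X.S, s.1 ⊆ R ∧ p ∈ (φ.toEquiv s).1}

/-- `φ` is induced by the bijection `f`: it sends every basis relation `s` to `s^f`. Since `φ` is
a bijection from `S` to `S'`, such an `f` satisfies `S^f = S'`, so it is an isomorphism. -/
def AlgIso.IsInducedBy {X : CoherentConfiguration Ω} {X' : CoherentConfiguration Ω'}
    (φ : AlgIso X X') (f : Ω ≃ Ω') : Prop :=
  ∀ s : X.S, (φ.toEquiv s).1 = Prod.map f f '' s.1

/-- The tensor product `s₁ ⊗ ⋯ ⊗ s_m` of relations on `Ω`, a relation on `Ω ^ m`. -/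
def tensorRel {m : ℕ} (s : Fin m → Set (Ω × Ω)) : Set ((Fin m → Ω) × (Fin m → Ω)) :=
  {p | ∀ i, (p.1 i, p.2 i) ∈ s i}

/-- The relation `1_Δ` on `Ω ^ m`, where `Δ = Diag(Ω ^ m)` is the set of constant tuples. -/
def diagRel (Ω : Type*) (m : ℕ) : Set ((Fin m → Ω) × (Fin m → Ω)) :=
  {p | p.1 = p.2 ∧ ∃ a : Ω, p.1 = fun _ => a}

/-- The `m`-extension of `X`: the smallest coherent configuration on `Ω ^ m` that contains the
Cartesian `m`-power of `X` and for which `Diag(Ω ^ m)` is a union of fibers. -/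
def extension [Finite Ω] (X : CoherentConfiguration Ω) (m : ℕ) :
    CoherentConfiguration (Fin m → Ω) :=
  WL ({R | ∃ s : Fin m → X.S, R = tensorRel fun i => (s i).1} ∪ {diagRel Ω m})

/-- `φ` is `m`-dimensional: the algebraic isomorphism `φ^m` between the Cartesian `m`-powers,
`s₁ ⊗ ⋯ ⊗ s_m ↦ φ(s₁) ⊗ ⋯ ⊗ φ(s_m)`, extends to an algebraic isomorphism between the
`m`-extensions that takes the diagonal to the diagonal. -/
def AlgIso.IsDimensional [Finite Ω] [Finite Ω'] {X : CoherentConfiguration Ω}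
    {X' : CoherentConfiguration Ω'} (φ : AlgIso X X') (m : ℕ) : Prop :=
  ∃ ψ : AlgIso (X.extension m) (X'.extension m),
    (∀ s : Fin m → X.S, ψ.mapRel (tensorRel fun i => (s i).1) =
      tensorRel fun i => (φ.toEquiv (s i)).1) ∧
    ψ.mapRel (diagRel Ω m) = diagRel Ω' m

/-- `X` is determined up to isomorphism by its `m`-dimensional intersection numbers: every
`m`-dimensional algebraic isomorphism from `X` to a coherent configuration on a finite set is
induced by a bijection. -/
def IsDeterminedBy.{u} {Ω : Type u} [Finite Ω] (X : CoherentConfiguration Ω) (m : ℕ) : Prop :=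
  ∀ (Ω' : Type u) [Finite Ω'] (X' : CoherentConfiguration Ω') (φ : AlgIso X X'),
    φ.IsDimensional m → ∃ f : Ω ≃ Ω', φ.IsInducedBy f

/-- The separability number `s(X)`: the smallest positive integer `m` such that every
`m`-dimensional algebraic isomorphism from `X` is induced by an isomorphism (and `⊤` if there
were no such `m`). -/
noncomputable def separabilityNumber.{u} {Ω : Type u} [Finite Ω] (X : CoherentConfiguration Ω) :
    ℕ∞ :=
  sInf {n | ∃ m : ℕ, 0 < m ∧ X.IsDeterminedBy m ∧ n = (m : ℕ∞)}

/-! ### The coherent configuration of a permutation group -/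

/-- `inv(G)`: the basis relations are the orbits of `G` on `Ω × Ω`. -/
def inv (G : Subgroup (Equiv.Perm Ω)) : CoherentConfiguration Ω where
  S := Set.range fun p : Ω × Ω => MulAction.orbit G p
  isPartition := by
    constructor
    · rintro ⟨p, hp⟩
      exact Set.notMem_empty p (hp ▸ MulAction.mem_orbit_self p)
    · intro p
      refine ⟨MulAction.orbit G p, ⟨⟨p, rfl⟩, MulAction.mem_orbit_self p⟩, ?_⟩
      rintro _ ⟨⟨x, rfl⟩, hx⟩
      exact (MulAction.orbit_eq_iff.2 hx).symm
  diagonal_union := by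
    refine ⟨Set.range fun a : Ω => MulAction.orbit G (a, a), ?_, ?_⟩
    · rintro _ ⟨a, rfl⟩
      exact ⟨(a, a), rfl⟩
    · ext ⟨a, b⟩
      constructor
      · rintro (rfl : a = b)
        exact ⟨_, ⟨a, rfl⟩, MulAction.mem_orbit_self _⟩
      · rintro ⟨_, ⟨c, rfl⟩, g, hg⟩
        simp only [Prod.smul_mk, Prod.mk.injEq] at hg
        exact hg.1.symm.trans hg.2
  converse_eq := by
    have h : ∀ x : Ω × Ω, converseRel (MulAction.orbit G x) = MulAction.orbit G x.swap := by
      rintro ⟨a, b⟩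
      ext ⟨c, d⟩
      constructor
      · rintro ⟨g, hg⟩
        simp only [Prod.smul_mk, Prod.mk.injEq] at hg
        exact ⟨g, by simp [hg.1, hg.2]⟩
      · rintro ⟨g, hg⟩
        simp only [Prod.swap_prod_mk, Prod.smul_mk, Prod.mk.injEq] at hg
        exact ⟨g, by simp [hg.1, hg.2]⟩
    ext s
    constructor
    · rintro ⟨_, ⟨x, rfl⟩, rfl⟩
      exact ⟨x.swap, (h x).symm⟩
    · rintro ⟨x, rfl⟩
      exact ⟨_, ⟨x.swap, rfl⟩, by rw [h]; simp⟩
  coherent := by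
    rintro _ ⟨x, rfl⟩ _ ⟨y, rfl⟩ _ ⟨z, rfl⟩ p hp p' hp'
    have hpp : p' ∈ MulAction.orbit G p := by
      rwa [MulAction.orbit_eq_iff.2 hp]
    obtain ⟨g, rfl⟩ := hpp
    have hinv : ∀ (w a : Ω × Ω), g • a ∈ MulAction.orbit G w ↔ a ∈ MulAction.orbit G w :=
      fun w a => by rw [← MulAction.orbit_eq_iff, MulAction.orbit_smul, MulAction.orbit_eq_iff]
    refine Set.ncard_congr (fun γ _ => g • γ) ?_ ?_ ?_
    · rintro γ ⟨h1, h2⟩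
      exact ⟨(hinv x (p.1, γ)).2 h1, (hinv y (γ, p.2)).2 h2⟩
    · intro a b _ _ hab
      exact smul_left_cancel g hab
    · rintro γ ⟨h1, h2⟩
      refine ⟨g⁻¹ • γ, ⟨?_, ?_⟩, smul_inv_smul g γ⟩
      · rw [← hinv x]
        simpa using h1
      · rw [← hinv y]
        simpa using h2

end CoherentConfiguration

/-! ### The small Hollmann scheme -/

/-- `f` is a semilinear bijection of `V` with companion field automorphism `σ`; the semilinear
bijections form the group `ΓL(V)`. -/
def IsSemilinear (K : Type*) {V : Type*} [Field K] [AddCommGroup V] [Module K V]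
    (f : V ≃+ V) (σ : K ≃+* K) : Prop :=
  ∀ (c : K) (v : V), f (c • v) = σ c • f v

/-- The point set of the small Hollmann scheme: the anisotropic binary quadratic forms over `K`
up to nonzero scalars. A form corresponds to the pair of its zeros on the projective line over
the quadratic extension of `K`, so for `|K| = q` these points are the `q (q - 1) / 2` pairs of
conjugate points of `PG(1, q ^ 2)` outside `PG(1, q)`. -/
def HollmannPoint (K : Type*) [Field K] : Type _ :=
  {P : ℙ K (QuadraticForm K (Fin 2 → K)) // P.rep.Anisotropic}

instance (K : Type*) [Field K] [Finite K] : Finite (HollmannPoint K) := by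
  have : Finite (QuadraticForm K (Fin 2 → K)) := DFunLike.finite _
  have : Finite (ℙ K (QuadraticForm K (Fin 2 → K))) := Quotient.finite _
  exact Subtype.finite

/-- The permutation group induced by `ΓL(2, K)`, hence by `PΓL(2, K)`, on the classes of
anisotropic binary quadratic forms: the semilinear map `f` with automorphism `σ` takes the class
of the form `Q` to the class of `σ ∘ Q ∘ f⁻¹`. -/
def PGammaL (K : Type*) [Field K] : Subgroup (Equiv.Perm (HollmannPoint K)) where
  carrier := {π | ∃ (f : (Fin 2 → K) ≃+ (Fin 2 → K)) (σ : K ≃+* K), IsSemilinear K f σ ∧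
    ∀ P : HollmannPoint K, ∃ c : Kˣ, ∀ v, (π P).1.rep v = c * σ (P.1.rep (f.symm v))}
  one_mem' := ⟨AddEquiv.refl _, RingEquiv.refl K, fun _ _ => rfl, fun P => ⟨1, fun v => by simp⟩⟩
  mul_mem' := by
    rintro π₁ π₂ ⟨f₁, σ₁, h₁, H₁⟩ ⟨f₂, σ₂, h₂, H₂⟩
    refine ⟨f₂.trans f₁, σ₂.trans σ₁, fun c v => ?_, fun P => ?_⟩
    · simp [h₁ _ _, h₂ _ _]
    · obtain ⟨c₁, hc₁⟩ := H₁ (π₂ P)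
      obtain ⟨c₂, hc₂⟩ := H₂ P
      refine ⟨c₁ * Units.map (σ₁ : K →* K) c₂, fun v => ?_⟩
      rw [Equiv.Perm.mul_apply, hc₁, hc₂]
      simp [mul_assoc]
  inv_mem' := by
    rintro π ⟨f, σ, h, H⟩
    refine ⟨f.symm, σ.symm, fun c v => ?_, fun P => ?_⟩
    · apply f.injective
      simp [h _ _]
    · obtain ⟨c, hc⟩ := H (π⁻¹ P)
      refine ⟨(Units.map (σ.symm : K →* K) c)⁻¹, fun v => ?_⟩
      have h1 := hc (f v)
      rw [← Equiv.Perm.mul_apply, mul_inv_cancel, Equiv.Perm.one_apply, AddEquiv.symm_apply_apply]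
        at h1
      simp [h1]

/-- The small Hollmann scheme over the finite field `K`. -/
def smallHollmannScheme (K : Type*) [Field K] : CoherentConfiguration (HollmannPoint K) :=
  CoherentConfiguration.inv (PGammaL K)

/-! ### Relations of a coherent configuration and of its extensions -/

/-! A point `x = (α, β, γ)` of `Ω³` plays the role of three individualized points. Suppose that the
3-extension separates the pairs `(x, (α, β, δ))` for different `δ`. An algebraic isomorphism of
3-extensions then sends the relation of each such pair to one with a unique pair starting at a
chosen image `x'` of `x`, and the last coordinates of the end points give the required bijection
(`exists_isInducedBy_of_determined`). So it suffices to find three points that determine all others.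
A point that is already determined helps with the rest, because its basis relation to any other
point cannot change under indistinguishability (`Indist.toSetoid_of_determined`).

Scaling the coefficient of `xy` to 1 turns the points into pairs `(a, c)` with `ac` of trace one.
The resultant `inv` of two such forms classifies pairs of distinct points under the linear group; a
semilinear map applies its field automorphism to it. The invariants of the three sides of a triangle
are tied to its area by an Artin–Schreier identity (`inv_add_inv`). From this, two distinct points
look alike from at most `2dq` points, and two distinct points `α, β` confine any point to at most
`4d²` candidates. Double counting (`exists_third_point`) yields a `γ` for which more than `2dq`
points are determined, and these separate everything, provided that `q` dominates `16d³`; this holds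
for `d ≥ 17`.

The primes 3 and 5 are treated separately. For `d = 3` the group is two-transitive, so only the
number of points matters. For `d = 5` an explicit triple is verified by computation in the field of
order 32: the classes of invariants with respect to the triple, refined by counts over a six-point
cell, determine eight points whose classes separate all 496 points. -/

namespace CoherentConfiguration

section Relations

variable {Ω : Type*} (X : CoherentConfiguration Ω)

theorem univ_mem_relations : Set.univ ∈ X.relations :=
  X.mem_relations_iff.2 fun _ _ _ _ => Set.mem_univ _

theorem mem_iff_of_toSetoid {R : Set (Ω × Ω)} (hR : R ∈ X.relations) {p p' : Ω × Ω}
    (h : X.toSetoid p p') : p ∈ R ↔ p' ∈ R :=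
  ⟨X.mem_relations_iff.1 hR _ _ h, X.mem_relations_iff.1 hR _ _ (X.toSetoid.symm h)⟩

theorem basis_mem_relations {s : Set (Ω × Ω)} (hs : s ∈ X.S) : s ∈ X.relations :=
  ⟨{s}, by simpa using hs, by simp⟩

/-- The composition is the set where a path count is nonzero, and path counts are constant on basis
relations. -/
theorem comp_mem_relations [Finite Ω] {R R' : Set (Ω × Ω)} (hR : R ∈ X.relations)
    (hR' : R' ∈ X.relations) : {p : Ω × Ω | ∃ z, (p.1, z) ∈ R ∧ (z, p.2) ∈ R'} ∈ X.relations := by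
  have key : ∀ p : Ω × Ω, (∃ z, (p.1, z) ∈ R ∧ (z, p.2) ∈ R') ↔ pathCount R R' p ≠ 0 := by
    intro p
    rw [pathCount, Ne, Set.ncard_eq_zero (Set.toFinite _), ← Ne, ← Set.nonempty_iff_ne_empty]
    rfl
  rw [mem_relations_iff]
  intro p p' h hp
  rw [Set.mem_ofPred_eq, key] at hp ⊢
  rw [← X.pathCount_congr hR hR' h]
  exact hp

/-- The basis relation containing the pair `p`. -/
noncomputable def basisOf (p : Ω × Ω) : X.S :=
  ⟨(X.exists_mem p).choose, (X.exists_mem p).choose_spec.1⟩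

theorem mem_basisOf (p : Ω × Ω) : p ∈ (X.basisOf p).1 := (X.exists_mem p).choose_spec.2

theorem eq_basisOf {p : Ω × Ω} {s : X.S} (h : p ∈ s.1) : s = X.basisOf p :=
  Subtype.ext (X.eq_of_mem s.2 (X.basisOf p).2 h (X.mem_basisOf p))

theorem toSetoid_of_mem {p p' : Ω × Ω} (s : X.S) (h : p ∈ s.1) (h' : p' ∈ s.1) :
    X.toSetoid p p' := ⟨s.1, s.2, h, h'⟩

theorem basisOf_subset {R : Set (Ω × Ω)} (hR : R ∈ X.relations) {p : Ω × Ω} (hp : p ∈ R) :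
    (X.basisOf p).1 ⊆ R := fun p' hp' =>
  X.mem_relations_iff.1 hR p p' (X.toSetoid_of_mem _ (X.mem_basisOf p) hp') hp

theorem subset_diagonal {s : X.S} {a : Ω} (h : (a, a) ∈ s.1) : s.1 ⊆ Set.diagonal Ω := by
  rw [X.eq_basisOf h]
  exact X.basisOf_subset X.diagonal_mem_relations rfl

theorem intersectionNumber_ne_zero_iff [Finite Ω] {r s t : X.S} {p : Ω × Ω} (hp : p ∈ t.1) :
    X.intersectionNumber r s t ≠ 0 ↔ ∃ z, (p.1, z) ∈ r.1 ∧ (z, p.2) ∈ s.1 := by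
  rw [← X.pathCount_eq_intersectionNumber r s t hp, pathCount, Ne,
    Set.ncard_eq_zero (Set.toFinite _), ← Ne, ← Set.nonempty_iff_ne_empty]
  rfl

theorem tensorRel_mem_relations [Finite Ω] {m : ℕ} {R : Fin m → Set (Ω × Ω)}
    (hR : ∀ i, R i ∈ X.relations) : tensorRel R ∈ (X.extension m).relations := by
  rw [mem_relations_iff]
  intro p p' h hp i
  have h1 : tensorRel (fun i => (X.basisOf (p.1 i, p.2 i)).1) ∈ (X.extension m).relations :=
    (WL_isLeast _).1 (Or.inl ⟨_, rfl⟩)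
  exact X.basisOf_subset (hR i) (hp i)
    ((mem_relations_iff _).1 h1 p p' h (fun i => X.mem_basisOf _) i)

theorem diagRel_mem_relations [Finite Ω] (m : ℕ) : diagRel Ω m ∈ (X.extension m).relations :=
  (WL_isLeast _).1 (Or.inr rfl)

/-- The pairs whose second entry has equal coordinates `i` and `j`. -/
theorem coord_eq_mem_relations [Finite Ω] {m : ℕ} (i j : Fin m) :
    {p : (Fin m → Ω) × (Fin m → Ω) | p.2 i = p.2 j} ∈ (X.extension m).relations := by
  classical
  have h1 : tensorRel (fun k => if k = i ∨ k = j then Set.diagonal Ω else Set.univ) ∈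
      (X.extension m).relations := X.tensorRel_mem_relations fun k => by
    split_ifs
    · exact X.diagonal_mem_relations
    · exact X.univ_mem_relations
  -- Walk from anywhere to a constant tuple and on to a tuple that agrees with it in places `i` and
  -- `j`: such end points are exactly those with equal coordinates there.
  have h2 := comp_mem_relations _ (univ_mem_relations (X.extension m))
    (comp_mem_relations _ (X.diagRel_mem_relations m) h1)
  convert h2 using 1
  ext ⟨x, y⟩
  simp only [Set.mem_ofPred_eq, Set.mem_univ, true_and]
  constructor
  · intro h
    refine ⟨fun _ => y i, fun _ => y i, ⟨rfl, _, rfl⟩, fun k => ?_⟩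
    dsimp only
    split_ifs with hk
    · rcases hk with rfl | rfl
      · rfl
      · exact h
    · trivial
  · rintro ⟨c, c', ⟨hc, a, ha⟩, h⟩
    obtain rfl : c = c' := hc
    obtain rfl : c = fun _ => a := ha
    have hi := h i
    have hj := h j
    simp only [true_or, or_true, if_true, Set.mem_diagonal_iff] at hi hj
    exact hi.symm.trans hj

end Relations

/-! ### Algebraic isomorphisms -/

section AlgIso

variable {Ω Ω' : Type*} {X' : CoherentConfiguration Ω'} {X : CoherentConfiguration Ω}

/-- The inverse of an algebraic isomorphism. -/
def AlgIso.symm (φ : AlgIso X X') : AlgIso X' X where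
  toEquiv := φ.toEquiv.symm
  map_intersectionNumber r s t := by
    rw [φ.map_intersectionNumber]
    simp

variable [Finite Ω] [Finite Ω']

theorem AlgIso.exists_path (φ : AlgIso X X') {r s t : X.S} {p : Ω × Ω} {p' : Ω' × Ω'}
    (hp : p ∈ t.1) (hp' : p' ∈ (φ.toEquiv t).1) (h : ∃ z, (p.1, z) ∈ r.1 ∧ (z, p.2) ∈ s.1) :
    ∃ z, (p'.1, z) ∈ (φ.toEquiv r).1 ∧ (z, p'.2) ∈ (φ.toEquiv s).1 := by
  rw [← X'.intersectionNumber_ne_zero_iff hp', ← φ.map_intersectionNumber]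
  exact (X.intersectionNumber_ne_zero_iff hp).2 h

/-- For `(a, b)` in the image of `s`, the path `a, a, b` pulls back to a path `p, z, p` whose second
step lies in `s`. This forces `z = p`, so the first step lies in `s` too, and the image of `s` is
the basis relation of `(a, a)`. -/
theorem AlgIso.subset_diagonal (φ : AlgIso X X') {s : X.S} (hs : s.1 ⊆ Set.diagonal Ω) :
    (φ.toEquiv s).1 ⊆ Set.diagonal Ω' := by
  obtain ⟨⟨a, b⟩, hab⟩ := X'.nonempty_of_mem (φ.toEquiv s).2
  obtain ⟨⟨p, p'⟩, hp⟩ := X.nonempty_of_mem s.2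
  obtain rfl : p = p' := hs hp
  have h := φ.symm.exists_path (r := X'.basisOf (a, a)) (s := φ.toEquiv s) (t := φ.toEquiv s)
    (p' := (p, p)) hab (by simpa [AlgIso.symm] using hp) ⟨a, X'.mem_basisOf _, hab⟩
  obtain ⟨z, h1, h2⟩ := h
  have h2' : (z, p) ∈ s.1 := by simpa [AlgIso.symm] using h2
  obtain rfl : z = p := hs h2'
  have h3 : s = φ.symm.toEquiv (X'.basisOf (a, a)) :=
    (X.eq_basisOf hp).trans (X.eq_basisOf h1).symm
  have h4 : φ.toEquiv s = X'.basisOf (a, a) := by simp [h3, AlgIso.symm]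
  rw [h4]
  exact X'.subset_diagonal (X'.mem_basisOf _)

theorem AlgIso.subset_diagonal_iff (φ : AlgIso X X') {s : X.S} :
    (φ.toEquiv s).1 ⊆ Set.diagonal Ω' ↔ s.1 ⊆ Set.diagonal Ω := by
  refine ⟨fun h => ?_, φ.subset_diagonal⟩
  simpa [AlgIso.symm] using φ.symm.subset_diagonal h

/-- A basis relation that contains a unique pair starting at `a` is mapped to one that contains a
unique pair starting at any corresponding point. -/
theorem AlgIso.existsUnique_of_existsUnique (φ : AlgIso X X') {a b : Ω} {a' : Ω'}
    (ha : (a', a') ∈ (φ.toEquiv (X.basisOf (a, a))).1)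
    (hb : ∀ c, X.toSetoid (a, b) (a, c) → b = c) :
    ∃! b', (a', b') ∈ (φ.toEquiv (X.basisOf (a, b))).1 := by
  have hu : ∀ c, (a, c) ∈ (X.basisOf (a, b)).1 → b = c := fun c hc =>
    hb c (X.toSetoid_of_mem _ (X.mem_basisOf _) hc)
  -- Uniqueness of `b` says that exactly one closed path `a, b, a` runs through these two relations;
  -- this number is transported.
  have hcount : X'.intersectionNumber (φ.toEquiv (X.basisOf (a, b)))
      (φ.toEquiv (X.basisOf (b, a))) (φ.toEquiv (X.basisOf (a, a))) = 1 := by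
    rw [← φ.map_intersectionNumber,
      ← X.pathCount_eq_intersectionNumber _ _ _ (X.mem_basisOf (a, a)), pathCount,
      Set.ncard_eq_one]
    refine ⟨b, Set.eq_singleton_iff_unique_mem.2 ⟨⟨X.mem_basisOf _, X.mem_basisOf _⟩, ?_⟩⟩
    rintro c ⟨hc, -⟩
    exact (hu c hc).symm
  rw [← X'.pathCount_eq_intersectionNumber _ _ _ ha, pathCount, Set.ncard_eq_one] at hcount
  obtain ⟨b', hb'⟩ := hcount
  have hmem : b' ∈ ({b'} : Set Ω') := rfl
  rw [← hb'] at hmem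
  refine ⟨b', hmem.1, fun c' hc' => ?_⟩
  -- The count only sees those `c'` whose way back to `a'` lies in the image of the relation of `(b,
  -- a)`. Pulling the closed path `a', c', a'` back shows that this is automatic.
  have h := φ.symm.exists_path (r := φ.toEquiv (X.basisOf (a, b))) (s := X'.basisOf (c', a'))
    (p' := (a, a)) ha (by simpa [AlgIso.symm] using X.mem_basisOf (a, a))
    ⟨c', hc', X'.mem_basisOf _⟩
  obtain ⟨z, h1, h2⟩ := h
  have h1' : (a, z) ∈ (X.basisOf (a, b)).1 := by simpa [AlgIso.symm] using h1
  obtain rfl := hu z h1'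
  have h3 : X'.basisOf (c', a') = φ.toEquiv (X.basisOf (b, a)) := by
    rw [← X.eq_basisOf h2]
    simp [AlgIso.symm]
  have : c' ∈ ({b'} : Set Ω') := by
    rw [← hb']
    exact ⟨hc', h3 ▸ X'.mem_basisOf _⟩
  exact this

end AlgIso

/-! ### Indistinguishability over three points -/

section Indist

variable {Ω : Type*} [Finite Ω] (X : CoherentConfiguration Ω)

/-- The points `δ` and `ε` are not distinguished by the `3`-extension over the points
`α, β, γ`. -/
def Indist (α β γ δ ε : Ω) : Prop :=
  (X.extension 3).toSetoid (![α, β, γ], ![α, β, δ]) (![α, β, γ], ![α, β, ε])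

/-- The point `w` is determined by `α, β, γ` in the `3`-extension. -/
def Determined (α β γ w : Ω) : Prop := ∀ w', X.Indist α β γ w w' → w = w'

variable {X} {α β γ : Ω}

/-- Coordinates 0 and 2 of `(α, β, α)` agree, which the 3-extension detects through the diagonal of
`Ω³`. -/
theorem determined_fst : X.Determined α β γ α := fun w' h => by
  simpa using ((X.extension 3).mem_iff_of_toSetoid (X.coord_eq_mem_relations 0 2) h).1 rfl

theorem determined_snd : X.Determined α β γ β := fun w' h => by
  simpa using ((X.extension 3).mem_iff_of_toSetoid (X.coord_eq_mem_relations 1 2) h).1 rfl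

theorem tensorRel_last_mem_relations {R : Set (Ω × Ω)} (hR : R ∈ X.relations) :
    {p : (Fin 3 → Ω) × (Fin 3 → Ω) | (p.1 2, p.2 2) ∈ R} ∈ (X.extension 3).relations := by
  have h := X.tensorRel_mem_relations (R := ![Set.univ, Set.univ, R]) (by
    intro i
    fin_cases i
    exacts [X.univ_mem_relations, X.univ_mem_relations, hR])
  convert h using 1
  ext p
  simp [tensorRel, Fin.forall_fin_succ]

theorem determined_trd : X.Determined α β γ γ := fun w' h => by
  simpa using ((X.extension 3).mem_iff_of_toSetoid
    (tensorRel_last_mem_relations X.diagonal_mem_relations) h).1 rfl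

/-- The relation `1 ⊗ 1 ⊗ Ω²` freezes the first two coordinates. -/
theorem eq_of_toSetoid_extension {δ : Ω} {z : Fin 3 → Ω}
    (h : (X.extension 3).toSetoid (![α, β, γ], ![α, β, δ]) (![α, β, γ], z)) :
    z = ![α, β, z 2] := by
  have h1 := X.tensorRel_mem_relations (R := ![Set.diagonal Ω, Set.diagonal Ω, Set.univ]) (by
    intro i
    fin_cases i
    exacts [X.diagonal_mem_relations, X.diagonal_mem_relations, X.univ_mem_relations])
  have h2 := ((X.extension 3).mem_iff_of_toSetoid h1 h).1 (by
    intro i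
    fin_cases i <;> simp)
  have e0 := h2 0
  have e1 := h2 1
  simp at e0 e1
  funext i
  fin_cases i
  · exact e0.symm
  · exact e1.symm
  · rfl

/-- Indistinguishable points have equally many neighbours in every set that is closed under
indistinguishability. -/
theorem Indist.ncard_eq {δ δ' : Ω} (h : X.Indist α β γ δ δ') {W : Set Ω}
    (hW : ∀ w ∈ W, ∀ w', X.Indist α β γ w w' → w' ∈ W) {R : Set (Ω × Ω)} (hR : R ∈ X.relations) :
    {w | w ∈ W ∧ (w, δ) ∈ R}.ncard = {w | w ∈ W ∧ (w, δ') ∈ R}.ncard := by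
  set U : Set ((Fin 3 → Ω) × (Fin 3 → Ω)) :=
    {p | ∃ w ∈ W, (X.extension 3).toSetoid (![α, β, γ], ![α, β, w]) p} with hU
  have hUrel : U ∈ (X.extension 3).relations := by
    rw [mem_relations_iff]
    rintro p p' hp ⟨w, hw, hwp⟩
    exact ⟨w, hw, (X.extension 3).toSetoid.trans hwp hp⟩
  -- The neighbours of `ε` in `W` correspond to the paths from `(α, β, γ)` through some `(α, β, w)`
  -- to `(α, β, ε)`, and coherence makes their number an invariant of the end pair.
  have key : ∀ ε : Ω, {w | w ∈ W ∧ (w, ε) ∈ R}.ncard =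
      pathCount U {p | (p.1 2, p.2 2) ∈ R} (![α, β, γ], ![α, β, ε]) := by
    intro ε
    refine Set.ncard_congr (fun w _ => ![α, β, w]) ?_ ?_ ?_
    · rintro w ⟨hw, hwe⟩
      exact ⟨⟨w, hw, (X.extension 3).toSetoid.refl _⟩, by simpa using hwe⟩
    · intro a b _ _ hab
      simpa using congrFun hab 2
    · rintro z ⟨⟨w, hw, hwz⟩, hz⟩
      have hz2 := eq_of_toSetoid_extension hwz
      refine ⟨z 2, ⟨hW w hw _ (?_ : X.Indist α β γ w (z 2)), by simpa using hz⟩, hz2.symm⟩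
      rw [Indist, ← hz2]
      exact hwz
  rw [key, key]
  exact (X.extension 3).pathCount_congr hUrel (tensorRel_last_mem_relations hR) h

/-- Neighbour counts over the closed set `{w}` are 0 or 1, so they detect the basis relation from
`w`. -/
theorem Indist.toSetoid_of_determined {δ δ' w : Ω} (h : X.Indist α β γ δ δ')
    (hw : X.Determined α β γ w) : X.toSetoid (w, δ) (w, δ') := by
  have h1 := h.ncard_eq (W := {w}) (by
    rintro _ rfl w' hw'
    exact (hw w' hw').symm) (X.basis_mem_relations (X.basisOf (w, δ)).2)
  have h2 : {v | v ∈ ({w} : Set Ω) ∧ (v, δ) ∈ (X.basisOf (w, δ)).1} = {w} := by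
    ext v
    constructor
    · rintro ⟨hv, -⟩
      exact hv
    · rintro rfl
      exact ⟨rfl, X.mem_basisOf _⟩
  rw [h2, Set.ncard_singleton] at h1
  have h3 : {v | v ∈ ({w} : Set Ω) ∧ (v, δ') ∈ (X.basisOf (w, δ)).1}.Nonempty := by
    rw [← Set.ncard_pos (Set.toFinite _), ← h1]
    exact one_pos
  obtain ⟨_, rfl, hv⟩ := h3
  exact X.toSetoid_of_mem _ (X.mem_basisOf _) hv

/-- If all points are determined by `α, β, γ` in the `3`-extension, then every `3`-dimensional
algebraic isomorphism is induced by a bijection. -/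
theorem exists_isInducedBy_of_determined (hdet : ∀ δ, X.Determined α β γ δ) {Ω' : Type*}
    [Finite Ω'] {X' : CoherentConfiguration Ω'} (φ : AlgIso X X') (hφ : φ.IsDimensional 3) :
    ∃ f : Ω ≃ Ω', φ.IsInducedBy f := by
  obtain ⟨ψ, hψ, -⟩ := hφ
  set x : Fin 3 → Ω := ![α, β, γ] with hx
  obtain ⟨⟨x', x''⟩, hx'⟩ :=
    (X'.extension 3).nonempty_of_mem (ψ.toEquiv ((X.extension 3).basisOf (x, x))).2
  obtain rfl : x' = x'' :=
    -- The relation of `(x, x)` lies in the diagonal, hence so does its image; the point found there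
    -- serves as image of `x`.
    ψ.subset_diagonal ((X.extension 3).subset_diagonal ((X.extension 3).mem_basisOf (x, x))) hx'
  have hunique : ∀ δ, ∃! z, (x', z) ∈
      (ψ.toEquiv ((X.extension 3).basisOf (x, ![α, β, δ]))).1 := fun δ =>
    ψ.existsUnique_of_existsUnique hx' fun c hc => by
      have hc2 := eq_of_toSetoid_extension hc
      rw [hc2, ← hdet δ (c 2)]
      rw [hc2] at hc
      exact hc
  choose z hz hzu using hunique
  -- images of tensor relations
  have htensor : ∀ {p : (Fin 3 → Ω) × (Fin 3 → Ω)} {p' : (Fin 3 → Ω') × (Fin 3 → Ω')},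
      p' ∈ (ψ.toEquiv ((X.extension 3).basisOf p)).1 →
      ∀ i, (p'.1 i, p'.2 i) ∈ (φ.toEquiv (X.basisOf (p.1 i, p.2 i))).1 := by
    intro p p' hp
    have h1 : p' ∈ ψ.mapRel (tensorRel fun i => (X.basisOf (p.1 i, p.2 i)).1) :=
      ⟨_, (X.extension 3).basisOf_subset (X.tensorRel_mem_relations fun i =>
        X.basis_mem_relations (X.basisOf _).2) fun i => X.mem_basisOf _, hp⟩
    rw [hψ] at h1
    exact h1
  -- The path `x, (α, β, δ₁), (α, β, δ₂)` has an image with the same end points; by uniqueness its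
  -- middle point is `z δ₁`, so the third tensor factor gives the claim.
  have hpair : ∀ δ₁ δ₂, (z δ₁ 2, z δ₂ 2) ∈ (φ.toEquiv (X.basisOf (δ₁, δ₂))).1 := by
    intro δ₁ δ₂
    obtain ⟨w, hw1, hw2⟩ := ψ.exists_path (r := (X.extension 3).basisOf (x, ![α, β, δ₁]))
      (s := (X.extension 3).basisOf (![α, β, δ₁], ![α, β, δ₂]))
      ((X.extension 3).mem_basisOf (x, ![α, β, δ₂])) (hz δ₂)
      ⟨![α, β, δ₁], (X.extension 3).mem_basisOf _, (X.extension 3).mem_basisOf _⟩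
    rw [hzu δ₁ w hw1] at hw2
    exact htensor hw2 2
  have hinj : Function.Injective fun δ => z δ 2 := by
    intro δ₁ δ₂ h
    have h1 := hpair δ₁ δ₂
    rw [show z δ₁ 2 = z δ₂ 2 from h] at h1
    exact φ.subset_diagonal_iff.1 (X'.subset_diagonal h1) (X.mem_basisOf (δ₁, δ₂))
  have hsurj : Function.Surjective fun δ => z δ 2 := by
    intro a
    -- Keeping the first two coordinates of `x'` forces the preimage to begin with `α, β`, since
    -- diagonal relations correspond to diagonal relations.
    set y' : Fin 3 → Ω' := ![x' 0, x' 1, a] with hy'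
    obtain ⟨y, hy, -⟩ := ψ.symm.exists_path (r := (X'.extension 3).basisOf (x', y'))
      (s := (X'.extension 3).basisOf (y', x')) (p' := (x, x)) hx'
      (by simpa [AlgIso.symm] using (X.extension 3).mem_basisOf (x, x))
      ⟨y', (X'.extension 3).mem_basisOf _, (X'.extension 3).mem_basisOf _⟩
    have hy2 : ψ.toEquiv ((X.extension 3).basisOf (x, y)) = (X'.extension 3).basisOf (x', y') := by
      rw [← (X.extension 3).eq_basisOf hy]
      simp [AlgIso.symm]
    have hmem : (x', y') ∈ (ψ.toEquiv ((X.extension 3).basisOf (x, y))).1 :=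
      hy2 ▸ (X'.extension 3).mem_basisOf _
    have hcoord : ∀ i, x' i = y' i → x i = y i := by
      intro i hi
      have h1 := htensor hmem i
      simp only [← hi] at h1
      exact φ.subset_diagonal_iff.1 (X'.subset_diagonal h1) (X.mem_basisOf (x i, y i))
    have hyeq : y = ![α, β, y 2] := by
      funext i
      fin_cases i
      · exact (hcoord 0 rfl).symm
      · exact (hcoord 1 rfl).symm
      · rfl
    rw [hyeq] at hmem
    exact ⟨y 2, by simp [← hzu _ _ hmem, hy']⟩
  refine ⟨Equiv.ofBijective _ ⟨hinj, hsurj⟩, fun s => ?_⟩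
  ext ⟨a, b⟩
  constructor
  · intro hab
    obtain ⟨δ₁, rfl⟩ := hsurj a
    obtain ⟨δ₂, rfl⟩ := hsurj b
    refine ⟨(δ₁, δ₂), ?_, rfl⟩
    have h1 : φ.toEquiv s = φ.toEquiv (X.basisOf (δ₁, δ₂)) :=
      (X'.eq_basisOf hab).trans (X'.eq_basisOf (hpair δ₁ δ₂)).symm
    rw [φ.toEquiv.injective h1]
    exact X.mem_basisOf _
  · rintro ⟨⟨δ₁, δ₂⟩, h, heq⟩
    obtain ⟨rfl, rfl⟩ := Prod.mk.inj heq
    rw [X.eq_basisOf h]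
    exact hpair δ₁ δ₂

end Indist

end CoherentConfiguration

/-! ### Coordinates on the small Hollmann scheme -/

section Coordinates

variable {K : Type*} [Field K]

theorem binary_form_apply (Q : QuadraticForm K (Fin 2 → K)) (v : Fin 2 → K) :
    Q v = Q ![1, 0] * v 0 ^ 2 + QuadraticMap.polar Q ![1, 0] ![0, 1] * (v 0 * v 1) +
      Q ![0, 1] * v 1 ^ 2 := by
  have hv : v = v 0 • ![1, 0] + v 1 • ![0, 1] := by
    funext i
    fin_cases i <;> simp
  conv_lhs => rw [hv, QuadraticMap.map_add Q]
  rw [QuadraticMap.map_smul, QuadraticMap.map_smul, QuadraticMap.polar_smul_left,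
    QuadraticMap.polar_smul_right]
  simp only [smul_eq_mul]
  ring

namespace HollmannPoint

/-- The coefficient of `xy` in a representative of `P`. -/
noncomputable def middle (P : HollmannPoint K) : K :=
  QuadraticMap.polar P.1.rep ![1, 0] ![0, 1]

/-- The coefficient of `x²` in the representative `a x² + xy + c y²` of `P`. -/
noncomputable def a (P : HollmannPoint K) : K := P.1.rep ![1, 0] / P.middle

/-- The coefficient of `y²` in the representative `a x² + xy + c y²` of `P`. -/
noncomputable def c (P : HollmannPoint K) : K := P.1.rep ![0, 1] / P.middle

/-- The invariant of a pair of points: the orbits of the linear group on pairs of points are its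
level sets. -/
noncomputable def inv (P R : HollmannPoint K) : K :=
  (P.a * R.c + R.a * P.c) ^ 2 + (P.a + R.a) * (P.c + R.c)

theorem inv_comm (P R : HollmannPoint K) : P.inv R = R.inv P := by
  simp only [inv]
  ring

/-- Twice the oriented area of a triangle in the affine plane of the forms `a x² + xy + c y²`. -/
noncomputable def area (P R D : HollmannPoint K) : K :=
  (D.a + P.a) * (R.c + P.c) + (R.a + P.a) * (D.c + P.c)

theorem exists_of_anisotropic {Q : QuadraticForm K (Fin 2 → K)} (hQ : Q.Anisotropic) :
    ∃ (P : HollmannPoint K) (u : Kˣ), ∀ v, P.1.rep v = u * Q v := by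
  have hQ0 : Q ≠ 0 := by
    rintro rfl
    simpa using congrFun (hQ ![1, 0] rfl) 0
  obtain ⟨u, hu⟩ := Projectivization.exists_smul_eq_mk_rep K Q hQ0
  have hrep : ∀ v, (Projectivization.mk K Q hQ0).rep v = u * Q v := fun v => by
    rw [← hu]
    rfl
  refine ⟨⟨Projectivization.mk K Q hQ0, fun v hv => hQ v ?_⟩, u, hrep⟩
  rw [hrep] at hv
  simpa using hv

/-- The quadratic form `x X² + z X Y + y Y²`. -/
def binaryForm (x z y : K) : QuadraticForm K (Fin 2 → K) :=
  x • QuadraticMap.proj 0 0 + z • QuadraticMap.proj 0 1 + y • QuadraticMap.proj 1 1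

theorem binaryForm_apply (x z y : K) (v : Fin 2 → K) :
    binaryForm x z y v = x * v 0 ^ 2 + z * (v 0 * v 1) + y * v 1 ^ 2 := by
  simp [binaryForm, QuadraticMap.proj_apply, sq]

theorem exists_coord {x y : K} (h : ∀ t, x * t ^ 2 + t + y ≠ 0) (hx : x ≠ 0) :
    ∃ P : HollmannPoint K, P.a = x ∧ P.c = y := by
  have hQa : (binaryForm x 1 y).Anisotropic := by
    intro v hv
    rw [binaryForm_apply] at hv
    by_cases h1 : v 1 = 0
    · have h0 : v 0 = 0 := by simpa [h1, hx] using hv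
      funext i
      fin_cases i
      exacts [h0, h1]
    · refine absurd ?_ (h (v 0 / v 1))
      field_simp
      linear_combination hv
  obtain ⟨P, u, hP⟩ := exists_of_anisotropic hQa
  have hm : P.middle = u := by
    rw [middle, QuadraticMap.polar, hP, hP, hP]
    simp only [binaryForm_apply]
    simp
    ring
  refine ⟨P, ?_, ?_⟩
  · rw [a, hm, hP, binaryForm_apply]
    simp
  · rw [c, hm, hP, binaryForm_apply]
    simp

/-- This is the key identity: two invariants of a triangle fix its area up to adding 1, and the area
together with one invariant linearizes the remaining conditions. -/
theorem inv_add_inv [CharP K 2] (P R D : HollmannPoint K) :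
    P.inv D + R.inv D = P.inv R + (area P R D ^ 2 + area P R D) := by
  have h2 : (2 : K) = 0 := CharTwo.two_eq_zero
  simp only [inv, area]
  grind

variable [Finite K] [CharP K 2]

theorem exists_sq_eq (x : K) : ∃ y, y ^ 2 = x := by
  obtain ⟨y, hy⟩ := (bijective_frobenius K 2).2 x
  exact ⟨y, hy⟩

/-- Without the mixed term a form over a perfect field of characteristic two is the square of a
linear form, hence isotropic. -/
theorem middle_ne_zero (P : HollmannPoint K) : P.middle ≠ 0 := by
  intro h
  have key := fun v (hv : P.1.rep v = 0) => P.2 v hv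
  obtain ⟨x, hx⟩ := exists_sq_eq (P.1.rep ![0, 1])
  obtain ⟨y, hy⟩ := exists_sq_eq (P.1.rep ![1, 0])
  have h1 : P.1.rep ![x, y] = 0 := by
    rw [binary_form_apply, show QuadraticMap.polar P.1.rep ![1, 0] ![0, 1] = 0 from h, ← hx, ← hy]
    simp only [Matrix.cons_val_zero, Matrix.cons_val_one]
    rw [zero_mul, add_zero, mul_comm]
    exact CharTwo.add_self_eq_zero _
  have h2 := key _ h1
  have hx0 : x = 0 := by simpa using congrFun h2 0
  have h3 := key ![0, 1] (by rw [← hx, hx0]; simp)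
  simpa using congrFun h3 1

theorem rep_apply (P : HollmannPoint K) (v : Fin 2 → K) :
    P.1.rep v = P.middle * (P.a * v 0 ^ 2 + v 0 * v 1 + P.c * v 1 ^ 2) := by
  have hm := P.middle_ne_zero
  rw [binary_form_apply, a, c, show QuadraticMap.polar P.1.rep ![1, 0] ![0, 1] = P.middle from rfl]
  field_simp

theorem form_ne_zero (P : HollmannPoint K) (t : K) : P.a * t ^ 2 + t + P.c ≠ 0 := by
  intro h
  have h1 := P.2 ![t, 1] (by rw [rep_apply]; simp [h])
  simpa using congrFun h1 1

theorem a_ne_zero (P : HollmannPoint K) : P.a ≠ 0 := by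
  intro h
  have h1 := P.2 ![1, 0] (by rw [rep_apply]; simp [h])
  simpa using congrFun h1 0

theorem ext_coord {P R : HollmannPoint K} (ha : P.a = R.a) (hc : P.c = R.c) : P = R := by
  apply Subtype.ext
  rw [← P.1.mk_rep, ← R.1.mk_rep, Projectivization.mk_eq_mk_iff']
  refine ⟨P.middle / R.middle, ?_⟩
  ext v
  have := R.middle_ne_zero
  rw [smul_apply, P.rep_apply, R.rep_apply, ha, hc, smul_eq_mul]
  field_simp

theorem inv_eq_zero_iff {P R : HollmannPoint K} : P.inv R = 0 ↔ P = R := by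
  have h2 : (2 : K) = 0 := CharTwo.two_eq_zero
  constructor
  · intro h
    by_cases hA : P.a = R.a
    · refine ext_coord hA ?_
      have h1 : P.a * (P.c + R.c) = 0 := by
        rw [← pow_eq_zero_iff (two_ne_zero)]
        simp only [inv] at h
        grind
      have h3 := (mul_eq_zero.1 h1).resolve_left P.a_ne_zero
      grind
    · have hA' : P.a + R.a ≠ 0 := fun h => hA (by grind)
      obtain ⟨t, ht⟩ := exists_sq_eq ((P.c + R.c) / (P.a + R.a))
      have ht' : P.c + R.c = t ^ 2 * (P.a + R.a) := by
        rw [ht]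
        field_simp
      refine absurd ?_ (P.form_ne_zero t)
      rw [← pow_eq_zero_iff (two_ne_zero)]
      -- For this `t` the left side is precisely `P.inv R`: a vanishing resultant would make `t` a
      -- zero of the form of `P`.
      have h3 : (P.a + R.a) ^ 2 * (P.a * t ^ 2 + t + P.c) ^ 2 = 0 := by
        simp only [inv] at h
        have h4 : R.c = P.c + t ^ 2 * (P.a + R.a) := by grind
        rw [h4] at h
        grind
      exact (mul_eq_zero.1 h3).resolve_left (pow_ne_zero _ hA')
  · rintro rfl
    simp only [inv]
    grind

/-- Two points with the same area and the same invariant with respect to a pair of points. -/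
theorem eq_or_of_area_eq {P R D E : HollmannPoint K} (hPR : P ≠ R)
    (harea : area P R D = area P R E) (hinv : P.inv D = P.inv E) :
    D = E ∨ (E.a = D.a + area P R D / P.inv R * (R.a + P.a) ∧
      E.c = D.c + area P R D / P.inv R * (R.c + P.c)) := by
  have h2 : (2 : K) = 0 := CharTwo.two_eq_zero
  have hs : P.inv R ≠ 0 := fun h => hPR (inv_eq_zero_iff.1 h)
  -- Equal areas over the side from `P` to `R` mean that `E - D` is parallel to that side.
  have hdir : ∃ t, E.a = D.a + t * (R.a + P.a) ∧ E.c = D.c + t * (R.c + P.c) := by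
    by_cases hA : R.a + P.a = 0
    · have hC : R.c + P.c ≠ 0 := fun h => hPR (ext_coord (by grind) (by grind))
      refine ⟨(E.c + D.c) / (R.c + P.c), ?_, ?_⟩
      · simp only [area, hA] at harea
        have : (E.a + D.a) * (R.c + P.c) = 0 := by grind
        have := (mul_eq_zero.1 this).resolve_right hC
        rw [hA]
        grind
      · field_simp
        grind
    · refine ⟨(E.a + D.a) / (R.a + P.a), ?_, ?_⟩
      · field_simp
        grind
      · field_simp
        simp only [area] at harea
        grind
  obtain ⟨t, hEa, hEc⟩ := hdir
  -- On that line the invariant with respect to `P` is quadratic in `t`; besides `t = 0` there is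
  -- one further solution.
  have h1 : t * (t * P.inv R + area P R D) = 0 := by
    simp only [inv, hEa, hEc] at hinv
    simp only [inv, area]
    grind
  rcases mul_eq_zero.1 h1 with rfl | h3
  · left
    exact ext_coord (by simp [hEa]) (by simp [hEc])
  · right
    have : t = area P R D / P.inv R := by
      rw [eq_div_iff hs]
      grind
    rw [← this]
    exact ⟨hEa, hEc⟩

/-- The action of a semilinear map in coordinates. -/
theorem coord_map {P R : HollmannPoint K} {σ : K ≃+* K} {f : (Fin 2 → K) ≃+ (Fin 2 → K)} {u : Kˣ}
    (hu : ∀ v, R.1.rep v = u * σ (P.1.rep (f.symm v))) {p r : Fin 2 → K}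
    (hp : f.symm ![1, 0] = p) (hr : f.symm ![0, 1] = r) : p 0 * r 1 + p 1 * r 0 ≠ 0 ∧
      R.a = σ ((P.a * p 0 ^ 2 + p 0 * p 1 + P.c * p 1 ^ 2) / (p 0 * r 1 + p 1 * r 0)) ∧
      R.c = σ ((P.a * r 0 ^ 2 + r 0 * r 1 + P.c * r 1 ^ 2) / (p 0 * r 1 + p 1 * r 0)) := by
  have h2 : (2 : K) = 0 := CharTwo.two_eq_zero
  have hmid : R.middle = u * σ (P.middle * (p 0 * r 1 + p 1 * r 0)) := by
    rw [middle, QuadraticMap.polar, hu, hu, hu, map_add, P.rep_apply, P.rep_apply, P.rep_apply,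
      hp, hr, ← mul_sub, ← mul_sub, ← map_sub, ← map_sub]
    congr 2
    simp only [Pi.add_apply]
    grind
  have hne : p 0 * r 1 + p 1 * r 0 ≠ 0 := by
    intro h0
    apply R.middle_ne_zero
    rw [hmid, h0]
    simp
  have hσ : σ (p 0 * r 1 + p 1 * r 0) ≠ 0 := (map_ne_zero σ).2 hne
  have hσm : σ P.middle ≠ 0 := (map_ne_zero σ).2 P.middle_ne_zero
  have := u.ne_zero
  refine ⟨hne, ?_, ?_⟩
  · rw [a, hmid, hu, P.rep_apply, hp, map_div₀, map_mul, map_mul]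
    field_simp
  · rw [c, hmid, hu, P.rep_apply, hr, map_div₀, map_mul, map_mul]
    field_simp

/-- The invariant is compatible with the action of the semilinear group. -/
theorem exists_inv_eq {π : Equiv.Perm (HollmannPoint K)} (hπ : π ∈ PGammaL K) :
    ∃ σ : K ≃+* K, ∀ P R : HollmannPoint K, (π P).inv (π R) = σ (P.inv R) := by
  have h2 : (2 : K) = 0 := CharTwo.two_eq_zero
  obtain ⟨f, σ, -, H⟩ := hπ
  refine ⟨σ, fun P R => ?_⟩
  obtain ⟨u, hu⟩ := H P
  obtain ⟨u', hu'⟩ := H R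
  obtain ⟨hne, hPa, hPc⟩ := coord_map hu rfl rfl
  obtain ⟨-, hRa, hRc⟩ := coord_map hu' rfl rfl
  rw [inv, hPa, hPc, hRa, hRc]
  simp only [← map_mul, ← map_add, ← map_pow]
  congr 1
  simp only [inv]
  field_simp
  grind

end HollmannPoint

end Coordinates

/-! ### Finite fields of characteristic two -/

section FiniteField

variable {K : Type*} [Field K]

/-- The Artin–Schreier map `y ↦ y² + y`. -/
def artinSchreier (K : Type*) [Field K] [CharP K 2] : K →+ K where
  toFun y := y ^ 2 + y
  map_zero' := by simp
  map_add' x y := by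
    rw [CharTwo.add_sq]
    ring

theorem artinSchreier_apply [CharP K 2] (y : K) : artinSchreier K y = y ^ 2 + y := rfl

theorem artinSchreier_eq_iff [CharP K 2] {x y : K} :
    artinSchreier K x = artinSchreier K y ↔ x = y ∨ x = y + 1 := by
  have h2 : (2 : K) = 0 := CharTwo.two_eq_zero
  rw [artinSchreier_apply, artinSchreier_apply]
  constructor
  · intro h
    have h1 : (x + y) * (x + y + 1) = 0 := by grind
    rcases mul_eq_zero.1 h1 with h | h
    · left; grind
    · right; grind
  · rintro (rfl | rfl) <;> grind

theorem card_ker_artinSchreier [CharP K 2] : Nat.card (artinSchreier K).ker = 2 := by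
  have : ((artinSchreier K).ker : Set K) = {0, 1} := by
    ext x
    rw [SetLike.mem_coe, AddMonoidHom.mem_ker, ← map_zero (artinSchreier K), artinSchreier_eq_iff]
    simp
  rw [← SetLike.coe_sort_coe, this, Nat.card_coe_set_eq, Set.ncard_pair zero_ne_one]

theorem two_mul_card_range_artinSchreier [CharP K 2] [Finite K] :
    2 * Nat.card (artinSchreier K).range = Nat.card K := by
  rw [← AddSubgroup.index_ker, ← card_ker_artinSchreier (K := K), AddSubgroup.card_mul_index]

theorem index_range_artinSchreier [CharP K 2] [Finite K] : (artinSchreier K).range.index = 2 := by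
  have h1 := two_mul_card_range_artinSchreier (K := K)
  have h2 := AddSubgroup.card_mul_index (artinSchreier K).range
  have h3 : 0 < Nat.card (artinSchreier K).range := Nat.card_pos
  rw [← h1, mul_comm] at h2
  exact Nat.eq_of_mul_eq_mul_right h3 h2

/-- A solution of `y² + y = 1` has multiplicative order 3, but 3 does not divide `2 ^ d - 1` for odd
`d`. -/
theorem one_notMem_range_artinSchreier [CharP K 2] [Finite K] {d : ℕ} (hd : Odd d)
    (hK : Nat.card K = 2 ^ d) : (1 : K) ∉ (artinSchreier K).range := by
  rintro ⟨y, hy⟩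
  have h2 : (2 : K) = 0 := CharTwo.two_eq_zero
  rw [artinSchreier_apply] at hy
  have hy3 : y ^ 3 = 1 := by grind
  have hy1 : y ≠ 1 := by
    rintro rfl
    grind
  have hy0 : y ≠ 0 := by
    rintro rfl
    simp at hy
  have ho : orderOf y = 3 := orderOf_eq_prime hy3 hy1
  have := Fintype.ofFinite K
  have hcard : y ^ (Nat.card K - 1) = 1 := by
    rw [Nat.card_eq_fintype_card]
    exact FiniteField.pow_card_sub_one_eq_one y hy0
  have hdvd := orderOf_dvd_of_pow_eq_one hcard
  rw [ho, hK] at hdvd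
  obtain ⟨k, rfl⟩ := hd
  have h4 : 2 ^ (2 * k + 1) % 3 = 2 := by
    rw [pow_succ, pow_mul, Nat.mul_mod, Nat.pow_mod]
    norm_num
  generalize 2 ^ (2 * k + 1) = N at hdvd h4
  omega

theorem charP_two_of_card [Finite K] {d : ℕ} (hK : Nat.card K = 2 ^ d) :
    CharP K 2 := by
  have := Fintype.ofFinite K
  obtain ⟨p, hp⟩ := CharP.exists K
  obtain ⟨n, hpp, hn⟩ := FiniteField.card K p
  rw [Nat.card_eq_fintype_card, hn] at hK
  have : p ∣ 2 ^ d := hK ▸ dvd_pow_self p n.ne_zero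
  have h2 := (Nat.prime_dvd_prime_iff_eq hpp Nat.prime_two).1 (hpp.dvd_of_dvd_pow this)
  exact h2 ▸ hp

instance RingEquiv.instFinite [Finite K] : Finite (K ≃+* K) := DFunLike.finite _

theorem card_ringEquiv_le [Finite K] [CharP K 2] {d : ℕ} (hK : Nat.card K = 2 ^ d) :
    Nat.card (K ≃+* K) ≤ d := by
  let _ : Algebra (ZMod 2) K := ZMod.algebra K 2
  have := Fintype.ofFinite K
  have hfr : Module.finrank (ZMod 2) K = d := by
    have h := Module.card_eq_pow_finrank (K := ZMod 2) (V := K)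
    rw [← Nat.card_eq_fintype_card, hK, ZMod.card] at h
    exact (Nat.pow_right_injective le_rfl h).symm
  have h1 : Nat.card (K ≃ₐ[ZMod 2] K) ≤ d := by
    rw [Nat.card_eq_fintype_card, ← hfr]
    exact AlgEquiv.card_le
  refine le_trans (Nat.card_le_card_of_injective
    (fun σ : K ≃+* K => (AlgEquiv.ofRingEquiv (f := σ) fun x => ?_ : K ≃ₐ[ZMod 2] K)) ?_) h1
  · have : (σ : K →+* K).comp (algebraMap (ZMod 2) K) = algebraMap (ZMod 2) K :=
      Subsingleton.elim _ _
    exact RingHom.congr_fun this x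
  · intro σ τ h
    ext x
    exact AlgEquiv.congr_fun h x

/-- The degree of `K` over the fixed field of `σ` divides the prime `d` and is not 1, so the fixed
field has two elements. -/
theorem eq_zero_or_one_of_fixed [Finite K] {d : ℕ} (hd : d.Prime) (hK : Nat.card K = 2 ^ d)
    {σ : K ≃+* K} (hσ : σ ≠ RingEquiv.refl K) {x : K} (hx : σ x = x) : x = 0 ∨ x = 1 := by
  classical
  let L : Subfield K := RingHom.eqLocusField (σ : K →+* K) (RingHom.id K)
  have hLmem : ∀ y, y ∈ L ↔ σ y = y := fun y => Iff.rfl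
  have := Fintype.ofFinite K
  have := Fintype.ofFinite L
  have hcard : 2 ^ d = Nat.card L ^ Module.finrank L K := by
    rw [← hK, Nat.card_eq_fintype_card, Nat.card_eq_fintype_card]
    exact Module.card_eq_pow_finrank
  have hm : Module.finrank L K ≠ 1 := by
    intro h1
    rw [h1, pow_one, ← hK] at hcard
    have htop : (L : Set K) = Set.univ :=
      Set.eq_of_subset_of_ncard_le (Set.subset_univ _)
        (by rw [Set.ncard_univ, hcard]; exact le_of_eq (Nat.card_coe_set_eq _))
    apply hσ
    ext y
    exact (hLmem y).1 (by rw [← SetLike.mem_coe, htop]; trivial)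
  have hdvd : Nat.card L ∣ 2 ^ d := by
    rw [hcard]
    exact dvd_pow_self _ Module.finrank_pos.ne'
  obtain ⟨e, -, he⟩ := (Nat.dvd_prime_pow Nat.prime_two).1 hdvd
  rw [he, ← pow_mul] at hcard
  have hem : d = e * Module.finrank L K := Nat.pow_right_injective le_rfl hcard
  have hmd : Module.finrank L K = d :=
    ((Nat.dvd_prime hd).1 (Dvd.intro_left e hem.symm)).resolve_left hm
  have he1 : e = 1 := by
    rw [hmd] at hem
    exact Nat.eq_of_mul_eq_mul_right hd.pos (by rw [← hem, one_mul])
  have hL2 : Fintype.card L = 2 := by rw [← Nat.card_eq_fintype_card, he, he1, pow_one]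
  have hz : (⟨x, (hLmem x).2 hx⟩ : L) ∈ ({0, 1} : Finset L) := by
    rw [Finset.eq_univ_of_card ({0, 1} : Finset L) (by rw [hL2]; simp)]
    exact Finset.mem_univ _
  simpa [Subtype.ext_iff] using hz

end FiniteField

/-! ### Counting points -/

theorem Set.ncard_le_mul_of_fiber_le {α β : Type*} [Finite α] [Finite β] {s : Set α} {t : Set β}
    (f : α → β) {n : ℕ} (hf : ∀ x ∈ s, f x ∈ t)
    (h : ∀ y ∈ t, {x | x ∈ s ∧ f x = y}.ncard ≤ n) : s.ncard ≤ n * t.ncard := by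
  classical
  have := Fintype.ofFinite α
  have := Fintype.ofFinite β
  rw [Set.ncard_eq_toFinset_card' s, Set.ncard_eq_toFinset_card' t]
  refine Finset.card_le_mul_card_image_of_maps_to (f := f) (fun x hx => ?_) n fun y hy => ?_
  · simpa using hf x (by simpa using hx)
  · have := h y (by simpa using hy)
    rw [Set.ncard_eq_toFinset_card'] at this
    refine le_trans (Finset.card_le_card fun x hx => ?_) this
    simpa using hx

theorem Set.ncard_le_two_of_eq_or {α : Type*} [Finite α] {s : Set α} {p : α → α → Prop}
    (h : ∀ x ∈ s, ∀ y ∈ s, x = y ∨ p x y) (hp : ∀ x y z, p x y → p x z → y = z) :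
    s.ncard ≤ 2 := by
  by_contra! hlt
  obtain ⟨x, y, z, hx, hy, hz, hxy, hxz, hyz⟩ := (Set.two_lt_ncard_iff (Set.toFinite s)).1 hlt
  exact hyz (hp x y z ((h x hx y hy).resolve_left hxy) ((h x hx z hz).resolve_left hxz))

namespace HollmannPoint

theorem exists_coord_of_notMem {K : Type*} [Field K] [CharP K 2] {x y : K}
    (h : x * y ∉ (artinSchreier K).range) :
    ∃ P : HollmannPoint K, P.a = x ∧ P.c = y := by
  have h2 : (2 : K) = 0 := CharTwo.two_eq_zero
  refine exists_coord (fun t ht => h ⟨x * t, ?_⟩) ?_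
  · rw [artinSchreier_apply]
    grind
  · rintro rfl
    exact h (by simp)

variable {K : Type*} [Field K] [Finite K] [CharP K 2]

theorem mul_notMem_range (P : HollmannPoint K) : P.a * P.c ∉ (artinSchreier K).range := by
  rintro ⟨y, hy⟩
  rw [artinSchreier_apply] at hy
  have ha := P.a_ne_zero
  refine P.form_ne_zero (y / P.a) ?_
  have h2 : (2 : K) = 0 := CharTwo.two_eq_zero
  field_simp
  grind

/-- Modulo the Artin–Schreier image, the invariant is the sum of two products `ac`, both outside
this subgroup of index two. -/
theorem inv_mem_range (P R : HollmannPoint K) : P.inv R ∈ (artinSchreier K).range := by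
  have h1 : P.a * P.c + R.a * R.c ∈ (artinSchreier K).range := by
    rw [AddSubgroup.add_mem_iff_of_index_two index_range_artinSchreier]
    exact iff_of_false P.mul_notMem_range R.mul_notMem_range
  have h2 : P.inv R = artinSchreier K (P.a * R.c + R.a * P.c) + (P.a * P.c + R.a * R.c) := by
    rw [inv, artinSchreier_apply]
    have h2 : (2 : K) = 0 := CharTwo.two_eq_zero
    grind
  rw [h2]
  exact add_mem ⟨_, rfl⟩ h1

theorem ncard_area_inv_le {P R : HollmannPoint K} (hPR : P ≠ R) (w s : K) :
    {D | area P R D = w ∧ P.inv D = s}.ncard ≤ 2 := by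
  refine Set.ncard_le_two_of_eq_or
    (p := fun D E => E.a = D.a + area P R D / P.inv R * (R.a + P.a) ∧
      E.c = D.c + area P R D / P.inv R * (R.c + P.c)) ?_ ?_
  · rintro D ⟨h1, h2⟩ E ⟨h3, h4⟩
    exact eq_or_of_area_eq hPR (h1.trans h3.symm) (h2.trans h4.symm)
  · rintro D E E' ⟨h1, h2⟩ ⟨h3, h4⟩
    exact ext_coord (h1.trans h3.symm) (h2.trans h4.symm)

/-- By `inv_add_inv` the area satisfies an Artin–Schreier equation, leaving two values; each is
attained by at most two points with the given first invariant. -/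
theorem ncard_inv_inv_le {P R : HollmannPoint K} (hPR : P ≠ R) (s t : K) :
    {D | P.inv D = s ∧ R.inv D = t}.ncard ≤ 4 := by
  rcases Set.eq_empty_or_nonempty {D | P.inv D = s ∧ R.inv D = t} with h0 | ⟨D₀, hs, ht⟩
  · rw [h0]
    simp
  have hle : ({area P R D₀, area P R D₀ + 1} : Set K).ncard ≤ 2 := by
    simp
  refine le_trans (Set.ncard_le_mul_of_fiber_le (area P R) (n := 2)
    (t := {area P R D₀, area P R D₀ + 1}) ?_ ?_) (Nat.mul_le_mul_left 2 hle)
  · rintro D ⟨h1, h2⟩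
    have e1 := inv_add_inv P R D
    have e2 := inv_add_inv P R D₀
    rw [h1, h2] at e1
    rw [hs, ht, e1] at e2
    exact artinSchreier_eq_iff.1 (add_left_cancel e2)
  · intro w _
    refine le_trans (Set.ncard_le_ncard ?_ (Set.toFinite _)) (ncard_area_inv_le hPR w s)
    rintro D ⟨⟨h1, -⟩, h2⟩
    exact ⟨h2, h1⟩

/-- For `σ = 1` the common value runs over the `q / 2` elements of the Artin–Schreier image, with at
most four points for each. For `σ ≠ 1`, points of equal area have invariants differing by an element
fixed by `σ`, thus by 0 or 1; since 1 is not in the Artin–Schreier image, the difference is 0. So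
each of the `q` areas contributes at most two points. -/
theorem ncard_inv_eq_map_inv_le {d : ℕ} (hd : d.Prime) (hodd : Odd d) (hK : Nat.card K = 2 ^ d)
    {P R : HollmannPoint K} (hPR : P ≠ R) (σ : K ≃+* K) :
    {D | R.inv D = σ (P.inv D)}.ncard ≤ 2 * Nat.card K := by
  by_cases hσ : σ = RingEquiv.refl K
  · subst hσ
    have hT : 2 * Nat.card K = 4 * ((artinSchreier K).range : Set K).ncard := by
      rw [← two_mul_card_range_artinSchreier (K := K), ← Nat.card_coe_set_eq]
      rw [SetLike.coe_sort_coe]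
      ring
    rw [hT]
    refine Set.ncard_le_mul_of_fiber_le (fun D => P.inv D) (fun D _ => P.inv_mem_range D) ?_
    intro y _
    refine le_trans (Set.ncard_le_ncard ?_ (Set.toFinite _)) (ncard_inv_inv_le hPR y y)
    rintro D ⟨h1, h2⟩
    exact ⟨h2, (show R.inv D = P.inv D from h1).trans h2⟩
  · rw [← Set.ncard_univ]
    refine Set.ncard_le_mul_of_fiber_le (area P R) (fun _ _ => Set.mem_univ _) ?_
    intro w _
    rcases Set.eq_empty_or_nonempty {D | D ∈ {D | R.inv D = σ (P.inv D)} ∧ area P R D = w} with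
      h0 | ⟨D₀, hD₀, hw₀⟩
    · rw [h0]
      simp
    refine le_trans (Set.ncard_le_ncard ?_ (Set.toFinite _))
      (ncard_area_inv_le hPR w (P.inv D₀))
    rintro D ⟨hD, hw⟩
    refine ⟨hw, ?_⟩
    have e1 := inv_add_inv P R D
    have e2 := inv_add_inv P R D₀
    rw [show R.inv D = _ from hD, hw] at e1
    rw [show R.inv D₀ = _ from hD₀, hw₀, ← e1] at e2
    have h2 : (2 : K) = 0 := CharTwo.two_eq_zero
    have hfix : σ (P.inv D + P.inv D₀) = P.inv D + P.inv D₀ := by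
      rw [map_add]
      grind
    rcases eq_zero_or_one_of_fixed hd hK hσ hfix with h | h
    · grind
    · refine absurd ?_ (one_notMem_range_artinSchreier hodd hK)
      rw [← h]
      exact add_mem (P.inv_mem_range D) (P.inv_mem_range D₀)

/-- The points `(u, t / u)` with `u ≠ 0` and `t` among the `q / 2` elements outside the
Artin–Schreier image are distinct. -/
theorem le_two_mul_card : Nat.card K * (Nat.card K - 1) ≤ 2 * Nat.card (HollmannPoint K) := by
  classical
  have := Fintype.ofFinite K
  set T : Set K := ((artinSchreier K).range : Set K)
  have hcardT : 2 * (Tᶜ).ncard = Nat.card K := by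
    have h1 : 2 * T.ncard = Nat.card K := by
      rw [← two_mul_card_range_artinSchreier (K := K), ← Nat.card_coe_set_eq]
      rfl
    have h2 := Set.ncard_add_ncard_compl T
    omega
  have hP : ∀ p : Kˣ × (Tᶜ : Set K), ∃ P : HollmannPoint K, P.a = p.1 ∧ P.c = p.2 / p.1 := by
    rintro ⟨u, ⟨t, ht⟩⟩
    refine exists_coord_of_notMem ?_
    rwa [mul_div_cancel₀ _ u.ne_zero]
  choose P hPa hPc using hP
  have hinj : Function.Injective P := by
    rintro ⟨u, t⟩ ⟨u', t'⟩ h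
    have ha : (u : K) = u' := by simpa [h, hPa] using (hPa (u, t)).symm
    obtain rfl := Units.ext ha
    have hc : (t : K) / u = t' / u := by simpa [h, hPc] using (hPc (u, t)).symm
    have hu := u.ne_zero
    rw [div_left_inj' hu] at hc
    rw [Subtype.ext hc]
  have hle := Nat.card_le_card_of_injective P hinj
  rw [Nat.card_prod, Nat.card_units, Nat.card_coe_set_eq] at hle
  calc Nat.card K * (Nat.card K - 1) = 2 * ((Nat.card K - 1) * (Tᶜ).ncard) := by
        rw [← hcardT]
        ring
    _ ≤ _ := Nat.mul_le_mul_left 2 hle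

theorem exists_inv_eq_of_toSetoid {P R P' R' : HollmannPoint K}
    (h : (smallHollmannScheme K).toSetoid (P, R) (P', R')) :
    ∃ σ : K ≃+* K, P'.inv R' = σ (P.inv R) := by
  obtain ⟨s, ⟨x, rfl⟩, ⟨g, hg⟩, ⟨g', hg'⟩⟩ := h
  obtain ⟨σ, hσ⟩ := exists_inv_eq (g' * g⁻¹).2
  refine ⟨σ, ?_⟩
  rw [← hσ]
  have h1 : (P', R') = (g' * g⁻¹) • (P, R) := by
    rw [← hg', ← hg]
    simp [smul_smul]
  rw [Prod.smul_mk, Prod.mk.injEq] at h1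
  rw [h1.1, h1.2]
  rfl

end HollmannPoint

/-! ### Large degree -/

section Counting

open Finset

/-- Let `E w x y` mean that `w` does not distinguish `x` from `y`. If every two points are
distinguished by all but at most `M` points and `α, β` leave at most `b` points undistinguished
from any given one, then a suitable third point isolates more than `M` points. -/
theorem exists_third_point {Ω : Type*} [Fintype Ω] (E : Ω → Ω → Ω → Prop) (M b : ℕ) (α β : Ω)
    (hM : ∀ x y, x ≠ y → {w | E w x y}.ncard ≤ M)
    (hb : ∀ x, {y | E α x y ∧ E β x y}.ncard ≤ b) (hn : b * M + M < Fintype.card Ω) :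
    ∃ γ, M < {x | ∀ y, E α x y → E β x y → E γ x y → x = y}.ncard := by
  classical
  by_contra! hcon
  simp only [Set.ncard_eq_toFinset_card', Set.toFinset_ofPred] at hM hb hcon
  set bad : Ω → Finset Ω := fun γ => {x | ∃ y, x ≠ y ∧ E α x y ∧ E β x y ∧ E γ x y} with hbad
  -- If the claim fails, each `γ` leaves at least `n - M > b * M` points `x` that are confused with
  -- another point.
  have h1 : ∀ γ, b * M + 1 ≤ #(bad γ) := by
    intro γ
    have h2 := hcon γ
    have h3 : #(univ : Finset Ω) ≤
        #({x | ∀ y, E α x y → E β x y → E γ x y → x = y} : Finset Ω) + #(bad γ) := by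
      refine le_trans (card_le_card fun x _ => ?_) (card_union_le _ _)
      simp only [hbad, mem_union, mem_filter_univ]
      by_contra! h
      obtain ⟨⟨y, hy1, hy2, hy3, hy4⟩, h⟩ := h
      exact h y hy4 hy1 hy2 hy3
    rw [card_univ] at h3
    omega
  -- Counted the other way, each `x` has at most `b` partners `y`, each confused with it by at most
  -- `M` points `γ`.
  have h4 : ∑ γ, #(bad γ) ≤ Fintype.card Ω * (b * M) := by
    calc ∑ γ, #(bad γ)
        ≤ ∑ γ, ∑ x, ∑ y ∈ ({y | E α x y ∧ E β x y} : Finset Ω),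
          (if x ≠ y ∧ E γ x y then 1 else 0) := by
          refine sum_le_sum fun γ _ => ?_
          rw [hbad, card_filter]
          refine sum_le_sum fun x _ => ?_
          split_ifs with h
          · obtain ⟨y, hxy, h1, h2, h3⟩ := h
            rw [← card_filter, Nat.succ_le_iff, card_pos]
            exact ⟨y, by simp [h1, h2, h3, hxy]⟩
          · exact Nat.zero_le _
      _ = ∑ x, ∑ y ∈ ({y | E α x y ∧ E β x y} : Finset Ω),
          ∑ γ, (if x ≠ y ∧ E γ x y then 1 else 0) := by
          rw [sum_comm]
          exact sum_congr rfl fun x _ => sum_comm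
      _ ≤ ∑ x : Ω, ∑ y ∈ ({y | E α x y ∧ E β x y} : Finset Ω), M := by
          refine sum_le_sum fun x _ => sum_le_sum fun y _ => ?_
          by_cases hxy : x = y
          · simp [hxy]
          · rw [← card_filter]
            simpa [hxy] using hM x y hxy
      _ ≤ ∑ x : Ω, b * M := by
          refine sum_le_sum fun x _ => ?_
          rw [sum_const, smul_eq_mul]
          exact Nat.mul_le_mul_right M (hb x)
      _ = Fintype.card Ω * (b * M) := by rw [sum_const, smul_eq_mul, card_univ]
  have h5 : ∑ _γ : Ω, (b * M + 1) ≤ ∑ γ, #(bad γ) := sum_le_sum fun γ _ => h1 γ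
  rw [sum_const, smul_eq_mul, card_univ] at h5
  have h6 : 0 < Fintype.card Ω := by omega
  nlinarith

end Counting

theorem Set.ncard_exists_le {α ι : Type*} [Finite α] [Finite ι] (p : ι → α → Prop) {n : ℕ}
    (h : ∀ i, {x | p i x}.ncard ≤ n) : {x | ∃ i, p i x}.ncard ≤ Nat.card ι * n := by
  classical
  have := Fintype.ofFinite α
  have := Fintype.ofFinite ι
  have h1 : {x | ∃ i, p i x} = ⋃ i, {x | p i x} := by
    ext x
    simp
  rw [h1, Nat.card_eq_fintype_card]
  calc (⋃ i, {x | p i x}).ncard ≤ ∑ i, {x | p i x}.ncard := Set.ncard_iUnion_le_of_fintype _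
    _ ≤ ∑ _i : ι, n := Finset.sum_le_sum fun i _ => h i
    _ = Fintype.card ι * n := by simp

/-- This is the numerical condition of the counting argument; it already fails at `d = 13`, where
`35205 > 8192`. -/
theorem two_pow_gt_of_seventeen_le {d : ℕ} (hd : 17 ≤ d) : 16 * d ^ 3 + 4 * d + 1 < 2 ^ d := by
  induction d, hd using Nat.le_induction with
  | base => norm_num
  | succ d hd ih =>
    rw [pow_succ 2 d]
    have h1 : (d + 1) ^ 3 = d ^ 3 + 3 * d ^ 2 + 3 * d + 1 := by ring
    have h2 : 17 * d ^ 2 ≤ d ^ 3 := by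
      rw [pow_succ d 2, mul_comm]
      exact Nat.mul_le_mul_left _ hd
    have h3 : 17 * d ≤ d ^ 2 := by
      rw [pow_two]
      exact Nat.mul_le_mul_right _ hd
    omega

namespace HollmannPoint

open CoherentConfiguration

theorem exists_ne_of_card {K : Type*} [Field K] [Finite K] (h : 2 ≤ Nat.card (HollmannPoint K)) :
    ∃ P R : HollmannPoint K, P ≠ R :=
  have := (Finite.one_lt_card_iff_nontrivial (α := HollmannPoint K)).1 h
  exists_pair_ne _

variable {K : Type*} [Field K] [Finite K] [CharP K 2]

/-- For large degree, some three points determine all points in the `3`-extension. -/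
theorem exists_determined {d : ℕ} (hd : d.Prime) (hK : Nat.card K = 2 ^ d) (hd17 : 17 ≤ d) :
    ∃ α β γ : HollmannPoint K, ∀ δ, (smallHollmannScheme K).Determined α β γ δ := by
  have := Fintype.ofFinite (HollmannPoint K)
  have hodd : Odd d := hd.odd_of_ne_two (by omega)
  have hgt := two_pow_gt_of_seventeen_le hd17
  have hn := le_two_mul_card (K := K)
  rw [hK, Nat.card_eq_fintype_card] at hn
  set q := 2 ^ d with hq
  have hN := card_ringEquiv_le hK
  -- With `M = 2dq`, `b = 4d²` and `n ≥ q(q - 1) / 2`, the condition `bM + M < n` follows from `16d³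
  -- + 4d + 1 < q`.
  have hbound : 4 * d ^ 2 * (d * (2 * q)) + d * (2 * q) < Fintype.card (HollmannPoint K) := by
    have h1 : q * (16 * d ^ 3 + 4 * d + 1) ≤ q * (q - 1) := Nat.mul_le_mul_left q (by omega)
    have h2 : q * (16 * d ^ 3 + 4 * d + 1) =
        2 * (4 * d ^ 2 * (d * (2 * q)) + d * (2 * q)) + q := by ring
    have h3 : 0 < q := by positivity
    omega
  have hpos : 0 < d * (2 * q) := by positivity
  obtain ⟨α, β, hαβ⟩ := exists_ne_of_card (K := K) (by
    rw [Nat.card_eq_fintype_card]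
    have : 0 < 4 * d ^ 2 * (d * (2 * q)) := by positivity
    omega)
  have hM : ∀ x y : HollmannPoint K, x ≠ y →
      {w | (smallHollmannScheme K).toSetoid (w, x) (w, y)}.ncard ≤ d * (2 * q) := by
    intro x y hxy
    refine le_trans (Set.ncard_le_ncard (t := {w | ∃ σ : K ≃+* K, y.inv w = σ (x.inv w)})
      (fun w hw => ?_) (Set.toFinite _)) (le_trans (Set.ncard_exists_le _ (n := 2 * q) fun σ => ?_)
        (Nat.mul_le_mul_right _ hN))
    · obtain ⟨σ, hσ⟩ := exists_inv_eq_of_toSetoid hw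
      exact ⟨σ, by rw [y.inv_comm, x.inv_comm, hσ]⟩
    · rw [← hK]
      exact ncard_inv_eq_map_inv_le hd hodd hK hxy σ
  obtain ⟨γ, hγ⟩ := exists_third_point
    (fun w x y => (smallHollmannScheme K).toSetoid (w, x) (w, y)) (d * (2 * q)) (4 * d ^ 2) α β hM
    (fun x => by
      refine le_trans (Set.ncard_le_ncard (t := {y | ∃ p : (K ≃+* K) × (K ≃+* K),
        α.inv y = p.1 (α.inv x) ∧ β.inv y = p.2 (β.inv x)}) ?_ (Set.toFinite _))
        (le_trans (Set.ncard_exists_le _ fun p => ncard_inv_inv_le hαβ _ _) ?_)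
      · rintro y ⟨h1, h2⟩
        obtain ⟨σ, hσ⟩ := exists_inv_eq_of_toSetoid h1
        obtain ⟨τ, hτ⟩ := exists_inv_eq_of_toSetoid h2
        exact ⟨(σ, τ), hσ, hτ⟩
      · rw [Nat.card_prod]
        calc _ ≤ d * d * 4 := Nat.mul_le_mul_right 4 (Nat.mul_le_mul hN hN)
          _ = 4 * d ^ 2 := by ring) hbound
  refine ⟨α, β, γ, fun δ δ' hδ => ?_⟩
  by_contra hne
  -- The isolated points are all determined, so none could distinguish `δ` from `δ'`; but more than
  -- `M` of them exist.
  refine absurd (hM δ δ' hne)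
    (not_le.2 (lt_of_lt_of_le hγ (Set.ncard_le_ncard ?_ (Set.toFinite _))))
  intro w hw
  refine hδ.toSetoid_of_determined fun w' hw' => ?_
  exact hw w' (hw'.toSetoid_of_determined determined_fst)
    (hw'.toSetoid_of_determined determined_snd) (hw'.toSetoid_of_determined determined_trd)

end HollmannPoint

/-! ### Degree three: the scheme has rank two -/

namespace CoherentConfiguration

/-- A configuration whose basis relations are the diagonal and its complement is determined by its
intersection numbers. -/
theorem exists_isInducedBy_of_rank_two {Ω Ω' : Type*} [Finite Ω] [Finite Ω'] [Nontrivial Ω]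
    {X : CoherentConfiguration Ω} {X' : CoherentConfiguration Ω'}
    (hdiag : ∀ a b : Ω, X.toSetoid (a, a) (b, b))
    (hoff : ∀ a b a' b' : Ω, a ≠ b → a' ≠ b' → X.toSetoid (a, b) (a', b')) (φ : AlgIso X X') :
    ∃ f : Ω ≃ Ω', φ.IsInducedBy f := by
  classical
  have hmem : ∀ (s : X.S) {p p' : Ω × Ω}, X.toSetoid p p' → (p ∈ s.1 ↔ p' ∈ s.1) := fun s p p' h =>
    X.mem_iff_of_toSetoid (X.basis_mem_relations s.2) h
  obtain ⟨a, b, hab⟩ := exists_pair_ne Ω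
  set e := X.basisOf (a, a) with he
  set o := X.basisOf (a, b) with ho
  have hemem : ∀ c d, (c, d) ∈ e.1 ↔ c = d := fun c d =>
    ⟨fun h => X.subset_diagonal (X.mem_basisOf (a, a)) h, by
      rintro rfl
      exact (hmem e (hdiag a c)).1 (X.mem_basisOf _)⟩
  have homem : ∀ c d, (c, d) ∈ o.1 ↔ c ≠ d := fun c d =>
    ⟨fun h hcd => hab (X.subset_diagonal (s := o) (a := c) (hcd ▸ h) (X.mem_basisOf (a, b))),
      fun h => (hmem o (hoff a b c d hab h)).1 (X.mem_basisOf _)⟩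
  have hS : ∀ s : X.S, s = e ∨ s = o := by
    intro s
    obtain ⟨⟨c, d⟩, hcd⟩ := X.nonempty_of_mem s.2
    rw [X.eq_basisOf hcd]
    by_cases h : c = d
    · left
      exact (X.eq_basisOf ((hemem c d).2 h)).symm
    · right
      exact (X.eq_basisOf ((homem c d).2 h)).symm
  have hesub : (φ.toEquiv e).1 ⊆ Set.diagonal Ω' :=
    φ.subset_diagonal fun p hp => (hemem p.1 p.2).1 hp
  have honot : ∀ c, (c, c) ∉ (φ.toEquiv o).1 := fun c hc =>
    hab (φ.subset_diagonal_iff.1 (X'.subset_diagonal hc) (X.mem_basisOf (a, b)))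
  have hS' : ∀ p, p ∈ (φ.toEquiv e).1 ∨ p ∈ (φ.toEquiv o).1 := by
    intro p
    rcases hS (φ.toEquiv.symm (X'.basisOf p)) with h | h
    · left
      rw [← h, Equiv.apply_symm_apply]
      exact X'.mem_basisOf p
    · right
      rw [← h, Equiv.apply_symm_apply]
      exact X'.mem_basisOf p
  have hemem' : ∀ c d, (c, d) ∈ (φ.toEquiv e).1 ↔ c = d := fun c d =>
    ⟨fun h => hesub h, by
      rintro rfl
      exact (hS' (c, c)).resolve_right (honot c)⟩
  have homem' : ∀ c d, (c, d) ∈ (φ.toEquiv o).1 ↔ c ≠ d := fun c d =>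
    ⟨by
      rintro h rfl
      exact honot c h, fun h => (hS' (c, d)).resolve_left fun h' => h (hesub h')⟩
  obtain ⟨⟨a', b'⟩, hab'⟩ := X'.nonempty_of_mem (φ.toEquiv e).2
  obtain rfl : a' = b' := hesub hab'
  -- This number is the number of points minus one, so both sets have the same size and any
  -- bijection works.
  have hcount := φ.map_intersectionNumber o o e
  rw [← X.pathCount_eq_intersectionNumber o o e ((hemem a a).2 rfl),
    ← X'.pathCount_eq_intersectionNumber _ _ _ hab', pathCount, pathCount] at hcount
  have h1 : {γ | ((a, a).1, γ) ∈ o.1 ∧ (γ, (a, a).2) ∈ o.1} = {a}ᶜ := by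
    ext γ
    simp [homem, eq_comm]
  have h2 : {γ | ((a', a').1, γ) ∈ (φ.toEquiv o).1 ∧ (γ, (a', a').2) ∈ (φ.toEquiv o).1} =
      {a'}ᶜ := by
    ext γ
    simp [homem', eq_comm]
  rw [h1, h2] at hcount
  have h3 := Set.ncard_add_ncard_compl ({a} : Set Ω)
  have h4 := Set.ncard_add_ncard_compl ({a'} : Set Ω')
  rw [Set.ncard_singleton] at h3 h4
  have hcard : Nat.card Ω = Nat.card Ω' := by omega
  refine ⟨(Finite.card_eq.1 hcard).some, fun s => ?_⟩
  generalize (Finite.card_eq.1 hcard).some = f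
  have himg : ∀ (t : Set (Ω × Ω)) (c d : Ω'),
      (c, d) ∈ Prod.map f f '' t ↔ (f.symm c, f.symm d) ∈ t := by
    intro t c d
    constructor
    · rintro ⟨⟨x, y⟩, hxy, h⟩
      obtain ⟨rfl, rfl⟩ := Prod.mk.inj h
      simpa using hxy
    · intro h
      exact ⟨_, h, by simp⟩
  ext ⟨c, d⟩
  rw [himg]
  rcases hS s with rfl | rfl
  · rw [hemem', hemem, f.symm.injective.eq_iff]
  · rw [homem', homem, f.symm.injective.ne_iff]

end CoherentConfiguration

/-! ### Transitivity of the semilinear group on pairs of points. -/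

namespace HollmannPoint

/-- Every semilinear bijection acts on the points. -/
theorem exists_perm {K : Type*} [Field K] [Finite K] {f : (Fin 2 → K) ≃+ (Fin 2 → K)}
    {σ : K ≃+* K} (hf : IsSemilinear K f σ) :
    ∃ π ∈ PGammaL K, ∀ P : HollmannPoint K, ∃ u : Kˣ,
      ∀ v, (π P).1.rep v = u * σ (P.1.rep (f.symm v)) := by
  have hfs : ∀ (x : K) v, f.symm (σ x • v) = x • f.symm v := fun x v => by
    apply f.injective
    rw [hf]
    simp
  have hform : ∀ P : HollmannPoint K, ∃ (R : HollmannPoint K) (u : Kˣ),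
      ∀ v, R.1.rep v = u * σ (P.1.rep (f.symm v)) := by
    intro P
    set Q := binaryForm (σ (P.1.rep (f.symm ![1, 0])))
      (σ (QuadraticMap.polar P.1.rep (f.symm ![1, 0]) (f.symm ![0, 1])))
      (σ (P.1.rep (f.symm ![0, 1]))) with hQ
    have hQv : ∀ v, Q v = σ (P.1.rep (f.symm v)) := by
      intro v
      obtain ⟨x, hx⟩ := σ.surjective (v 0)
      obtain ⟨y, hy⟩ := σ.surjective (v 1)
      have hv : v = σ x • ![1, 0] + σ y • ![0, 1] := by
        funext i
        fin_cases i <;> simp [hx, hy]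
      have h1 : f.symm v = x • f.symm ![1, 0] + y • f.symm ![0, 1] := by
        conv_lhs => rw [hv, map_add, hfs, hfs]
      rw [h1, QuadraticMap.map_add P.1.rep, QuadraticMap.map_smul, QuadraticMap.map_smul,
        QuadraticMap.polar_smul_left, QuadraticMap.polar_smul_right, hQ, binaryForm_apply,
        ← hx, ← hy]
      simp only [smul_eq_mul, map_add, map_mul]
      ring
    have hQa : Q.Anisotropic := by
      intro v hv
      rw [hQv, map_eq_zero_iff σ σ.injective] at hv
      simpa using P.2 _ hv
    obtain ⟨R, u, hR⟩ := exists_of_anisotropic hQa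
    exact ⟨R, u, fun v => by rw [hR, hQv]⟩
  choose m u hm using hform
  have hinj : Function.Injective m := by
    intro P R h
    apply Subtype.ext
    rw [← P.1.mk_rep, ← R.1.mk_rep, Projectivization.mk_eq_mk_iff']
    refine ⟨σ.symm ((u P)⁻¹ * u R), ?_⟩
    ext v
    apply σ.injective
    have h1 := hm P (f v)
    have h2 := hm R (f v)
    rw [h, h2, f.symm_apply_apply] at h1
    rw [smul_apply, smul_eq_mul, map_mul, RingEquiv.apply_symm_apply, mul_assoc, h1,
      Units.inv_mul_cancel_left]
  exact ⟨Equiv.ofBijective m (Finite.injective_iff_bijective.1 hinj), ⟨f, σ, hf, fun P =>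
    ⟨u P, hm P⟩⟩, fun P => ⟨u P, hm P⟩⟩

variable {K : Type*} [Field K] [Finite K] [CharP K 2]

/-- The action of a field automorphism on the coefficients. -/
theorem exists_perm_map (σ : K ≃+* K) :
    ∃ π ∈ PGammaL K, ∀ P : HollmannPoint K, (π P).a = σ P.a ∧ (π P).c = σ P.c := by
  obtain ⟨π, hπ, H⟩ := exists_perm (K := K)
    (f := AddEquiv.piCongrRight fun _ => (σ : K ≃+ K)) (σ := σ) (fun x v => by
      funext i
      simp)
  refine ⟨π, hπ, fun P => ?_⟩
  obtain ⟨u, hu⟩ := H P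
  obtain ⟨-, h1, h2⟩ := coord_map hu (p := ![1, 0]) (r := ![0, 1])
    (by funext i; fin_cases i <;> simp) (by funext i; fin_cases i <;> simp)
  constructor
  · rw [h1]
    simp
  · rw [h2]
    simp

/-- The linear map of determinant one given by a matrix with columns `p` and `r`, as the inverse of
an additive equivalence. -/
def unimodular {K : Type*} [Field K] [CharP K 2] (p r : Fin 2 → K) (h : p 0 * r 1 + p 1 * r 0 = 1) :
    (Fin 2 → K) ≃+ (Fin 2 → K) where
  toFun v := ![r 1 * v 0 + r 0 * v 1, p 1 * v 0 + p 0 * v 1]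
  invFun v := v 0 • p + v 1 • r
  left_inv v := by
    have h2 : (2 : K) = 0 := CharTwo.two_eq_zero
    funext i
    fin_cases i <;> simp <;> grind
  right_inv v := by
    have h2 : (2 : K) = 0 := CharTwo.two_eq_zero
    funext i
    fin_cases i <;> simp <;> grind
  map_add' v w := by
    funext i
    fin_cases i <;> simp <;> ring

/-- Every pair of points can be moved to a standard pair with the same invariant. -/
theorem exists_perm_standard {P R : HollmannPoint K} (hPR : P ≠ R) {s e : K}
    (hs : s ^ 2 = P.inv R) (he : s * e ∉ (artinSchreier K).range) :
    ∃ π ∈ PGammaL K, ((π P).a = s ∧ (π P).c = e) ∧ ((π R).a = s ∧ (π R).c = e + 1) := by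
  have h2 : (2 : K) = 0 := CharTwo.two_eq_zero
  have hs0 : s ≠ 0 := by
    rintro rfl
    exact hPR (inv_eq_zero_iff.1 (by rw [← hs]; simp))
  obtain ⟨u, hu⟩ := exists_sq_eq (P.a + R.a)
  obtain ⟨w, hw⟩ := exists_sq_eq (P.c + R.c)
  have hRa : R.a = P.a + u ^ 2 := by grind
  have hRc : R.c = P.c + w ^ 2 := by grind
  -- The two forms differ by `(uX + wY)²`, so they agree at `(w, u)`. The square of their common
  -- value there is the invariant, so the value is `s`. This vector becomes the new first basis
  -- vector.
  have hval : P.a * w ^ 2 + w * u + P.c * u ^ 2 = s := by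
    have h3 : (P.a * w ^ 2 + w * u + P.c * u ^ 2 + s) ^ 2 = 0 := by
      have : s ^ 2 = (P.a * R.c + R.a * P.c) ^ 2 + (P.a + R.a) * (P.c + R.c) := hs
      rw [hRa, hRc] at this
      grind
    have h4 := pow_eq_zero_iff (two_ne_zero) |>.1 h3
    grind
  -- With determinant one, the difference `(uX + wY)²` takes the value 1 at the second basis vector,
  -- whence `e` and `e + 1`.
  obtain ⟨x, y, hxy⟩ : ∃ x y, w * y + u * x = 1 := by
    by_cases hw0 : w = 0
    · have hu0 : u ≠ 0 := by
        rintro rfl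
        apply hs0
        rw [← hval, hw0]
        simp
      exact ⟨u⁻¹, 0, by simp [hu0]⟩
    · exact ⟨0, w⁻¹, by simp [hw0]⟩
  set e' := P.a * x ^ 2 + x * y + P.c * y ^ 2 with he'
  have hse' : s * e' ∉ (artinSchreier K).range := by
    rintro ⟨z, hz⟩
    rw [artinSchreier_apply] at hz
    -- the form vanishes at `z • (w, u) + s • (x, y)`
    have hzero : P.a * (z * w + s * x) ^ 2 + (z * w + s * x) * (z * u + s * y) +
        P.c * (z * u + s * y) ^ 2 = 0 := by grind
    have h5 := P.2 ![z * w + s * x, z * u + s * y] (by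
      rw [rep_apply]
      simp [hzero])
    have h6 : z * w + s * x = 0 := by simpa using congrFun h5 0
    have h7 : z * u + s * y = 0 := by simpa using congrFun h5 1
    apply hs0
    grind
  obtain ⟨z, hz⟩ : s * e' + s * e ∈ (artinSchreier K).range := by
    rw [AddSubgroup.add_mem_iff_of_index_two index_range_artinSchreier]
    exact iff_of_false hse' he
  rw [artinSchreier_apply] at hz
  -- Adding `t • (w, u)` to the second vector changes the value there by `s * t ^ 2 + t`. The
  -- required change is attainable because `s * e` and `s * e'` both lie outside the Artin–Schreier
  -- image.
  obtain ⟨t, ht⟩ : ∃ t, z = s * t := ⟨z / s, by field_simp⟩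
  have ht' : s * t ^ 2 + t = e' + e := by
    apply mul_left_cancel₀ hs0
    rw [ht] at hz
    grind
  have hdet : (![w, u] : Fin 2 → K) 0 * (![x + t * w, y + t * u] : Fin 2 → K) 1 +
      (![w, u] : Fin 2 → K) 1 * (![x + t * w, y + t * u] : Fin 2 → K) 0 = 1 := by
    simp
    grind
  obtain ⟨π, hπ, H⟩ := exists_perm (K := K) (f := unimodular ![w, u] ![x + t * w, y + t * u] hdet)
    (σ := RingEquiv.refl K) (fun k v => by
      funext i
      fin_cases i <;> simp [unimodular] <;> ring)
  have hcol1 : (unimodular ![w, u] ![x + t * w, y + t * u] hdet).symm ![1, 0] = ![w, u] := by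
    funext i
    fin_cases i <;> simp [unimodular]
  have hcol2 : (unimodular ![w, u] ![x + t * w, y + t * u] hdet).symm ![0, 1] =
      ![x + t * w, y + t * u] := by
    funext i
    fin_cases i <;> simp [unimodular]
  refine ⟨π, hπ, ?_, ?_⟩
  · obtain ⟨k, hk⟩ := H P
    obtain ⟨-, h3, h4⟩ := coord_map hk hcol1 hcol2
    rw [hdet, div_one] at h3 h4
    simp at h3 h4
    constructor
    · rw [h3, hval]
    · rw [h4]
      grind
  · obtain ⟨k, hk⟩ := H R
    obtain ⟨-, h3, h4⟩ := coord_map hk hcol1 hcol2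
    rw [hdet, div_one] at h3 h4
    simp at h3 h4
    constructor
    · rw [h3]
      grind
    · rw [h4]
      grind

/-- Two pairs of points with the same invariant are equivalent. -/
theorem exists_perm_of_inv_eq {P R P' R' : HollmannPoint K} (hPR : P ≠ R)
    (h : P.inv R = P'.inv R') : ∃ π ∈ PGammaL K, π P = P' ∧ π R = R' := by
  have hPR' : P' ≠ R' := by
    rw [Ne, ← inv_eq_zero_iff, ← h, inv_eq_zero_iff]
    exact hPR
  obtain ⟨s, hs⟩ := exists_sq_eq (P.inv R)
  have hs0 : s ≠ 0 := by
    rintro rfl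
    exact hPR (inv_eq_zero_iff.1 (by rw [← hs]; simp))
  obtain ⟨π, hπ, ⟨h1, h2⟩, h3, h4⟩ := exists_perm_standard hPR (s := s)
    (e := P.a * P.c / s) hs (by
      rw [mul_div_cancel₀ _ hs0]
      exact P.mul_notMem_range)
  obtain ⟨π', hπ', ⟨h1', h2'⟩, h3', h4'⟩ := exists_perm_standard hPR' (s := s)
    (e := P.a * P.c / s) (hs.trans h) (by
      rw [mul_div_cancel₀ _ hs0]
      exact P.mul_notMem_range)
  refine ⟨π'⁻¹ * π, mul_mem (inv_mem hπ') hπ, ?_, ?_⟩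
  · rw [Equiv.Perm.mul_apply, Equiv.Perm.inv_eq_iff_eq]
    exact ext_coord (h1.trans h1'.symm) (h2.trans h2'.symm)
  · rw [Equiv.Perm.mul_apply, Equiv.Perm.inv_eq_iff_eq]
    exact ext_coord (h3.trans h3'.symm) (h4.trans h4'.symm)

/-- Substituting `x = y² + y` and `y⁸ = y` gives `x + x² + x⁴ = 0`; divide by `x`. -/
theorem cubic_of_mem_range (hK : Nat.card K = 2 ^ 3) {x : K} (hx : x ∈ (artinSchreier K).range)
    (hx0 : x ≠ 0) : x ^ 3 + x + 1 = 0 := by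
  have h2 : (2 : K) = 0 := CharTwo.two_eq_zero
  have := Fintype.ofFinite K
  obtain ⟨y, rfl⟩ := hx
  rw [artinSchreier_apply] at hx0 ⊢
  have hy : y ^ 8 = y := by
    have := FiniteField.pow_card y
    rwa [← Nat.card_eq_fintype_card, hK] at this
  apply mul_left_cancel₀ hx0
  grind

/-- The group of the small Hollmann scheme of degree `28` is two-transitive. -/
theorem exists_perm_of_card_eight (hK : Nat.card K = 2 ^ 3) {P R P' R' : HollmannPoint K}
    (hPR : P ≠ R) (hPR' : P' ≠ R') : ∃ π ∈ PGammaL K, π P = P' ∧ π R = R' := by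
  have h2 : (2 : K) = 0 := CharTwo.two_eq_zero
  have hx := cubic_of_mem_range hK (P.inv_mem_range R) fun h => hPR (inv_eq_zero_iff.1 h)
  have hy := cubic_of_mem_range hK (P'.inv_mem_range R') fun h => hPR' (inv_eq_zero_iff.1 h)
  obtain ⟨σ, hσ⟩ : ∃ σ : K ≃+* K, σ (P.inv R) = P'.inv R' := by
    generalize P.inv R = x at hx
    generalize P'.inv R' = y at hy
    -- The roots of `X³ + X + 1` are `x, x², x⁴`, so `y` is conjugate to `x`.
    have hprod : (y + x) * ((y + x ^ 2) * (y + x ^ 4)) = 0 := by grind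
    rcases mul_eq_zero.1 hprod with h | h
    · exact ⟨RingEquiv.refl K, by simp; grind⟩
    rcases mul_eq_zero.1 h with h | h
    · exact ⟨frobeniusEquiv K 2, by rw [frobeniusEquiv_apply, frobenius_def]; grind⟩
    · refine ⟨(frobeniusEquiv K 2).trans (frobeniusEquiv K 2), ?_⟩
      rw [RingEquiv.trans_apply, frobeniusEquiv_apply, frobeniusEquiv_apply, frobenius_def,
        frobenius_def]
      grind
  obtain ⟨π, hπ, H⟩ := exists_perm_map σ
  obtain ⟨π', hπ', h1, h2⟩ := exists_perm_of_inv_eq (π.injective.ne hPR) (P' := P') (R' := R') (by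
    rw [← hσ]
    simp only [inv, (H _).1, (H _).2, map_add, map_mul, map_pow])
  exact ⟨π' * π, mul_mem hπ' hπ, h1, h2⟩

open CoherentConfiguration in
theorem isDeterminedBy_of_card_eight (hK : Nat.card K = 2 ^ 3) :
    (smallHollmannScheme K).IsDeterminedBy 3 := by
  intro Ω' _ X' φ _
  have : Nontrivial (HollmannPoint K) := by
    rw [← Finite.one_lt_card_iff_nontrivial]
    have := le_two_mul_card (K := K)
    rw [hK] at this
    omega
  have hS : ∀ {P R P' R' : HollmannPoint K}, (∃ π ∈ PGammaL K, π P = P' ∧ π R = R') →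
      (smallHollmannScheme K).toSetoid (P, R) (P', R') := by
    rintro P R P' R' ⟨π, hπ, rfl, rfl⟩
    exact ⟨_, ⟨(P, R), rfl⟩, MulAction.mem_orbit_self _, ⟨⟨π, hπ⟩, rfl⟩⟩
  refine exists_isInducedBy_of_rank_two (fun P R => hS ?_) (fun P R P' R' h h' => hS ?_) φ
  · obtain ⟨P', hP'⟩ := exists_ne P
    obtain ⟨R', hR'⟩ := exists_ne R
    obtain ⟨π, hπ, h, -⟩ := exists_perm_of_card_eight hK hP'.symm hR'.symm
    exact ⟨π, hπ, h, h⟩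
  · exact exists_perm_of_card_eight hK h h'

end HollmannPoint

/-! ### Degree five: computation in the field of order `32`

The elements of the field are encoded by the natural numbers below `32`, whose binary digits are
the coordinates with respect to the powers of a zero of `X⁵ + X² + 1`. -/

namespace GF32

/-- Multiplication by the generator. -/
def mulX (a : ℕ) : ℕ := Nat.xor (Nat.mul 2 a) (Nat.mul (Nat.div a 16) 37)

/-- A step of the Horner scheme. -/
def mulStep (a b i r : ℕ) : ℕ := Nat.xor (mulX r) (Nat.mul (Nat.mod (Nat.div b (Nat.pow 2 i)) 2) a)

/-- Multiplication. -/
def mul (a b : ℕ) : ℕ :=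
  mulStep a b 0 (mulStep a b 1 (mulStep a b 2 (mulStep a b 3 (mulStep a b 4 0))))

/-- The invariant of the points with coordinates `(a, c)` and `(b, e)`. -/
def coordInv (a c b e : ℕ) : ℕ :=
  Nat.xor (mul (Nat.xor (mul a e) (mul b c)) (Nat.xor (mul a e) (mul b c)))
    (mul (Nat.xor a b) (Nat.xor c e))

/-- A table of the classes of conjugate elements of trace zero. -/
def cls (x : ℕ) : ℕ := Nat.mod (Nat.div 14431822603059208464 (Nat.pow 4 x)) 4

/-- The class of the invariant of the points encoded by `p` and `r`, where `32 a + c` encodes the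
point with coordinates `(a, c)`. -/
def pairClass (p r : ℕ) : ℕ :=
  cls (coordInv (Nat.div p 32) (Nat.mod p 32) (Nat.div r 32) (Nat.mod r 32))

/-- The characteristic function of the image of the Artin–Schreier map. -/
def isTraceZero (x : ℕ) : Bool := Nat.beq (Nat.mod (Nat.div 2857740885 (Nat.pow 2 x)) 2) 1

/-- The codes of all points. -/
def points : List ℕ := (List.range 1024).filter fun p => !isTraceZero (mul (p / 32) (p % 32))

/-- The codes of the points in prescribed classes with respect to the points `33, 504, 247`. -/
def cell : List ℕ :=
  points.filter fun p => pairClass 33 p == 1 && pairClass 504 p == 1 && pairClass 247 p == 2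

/-- The number of elements of `cell` whose invariant with respect to `p` has class `k`. -/
def cellCount (k p : ℕ) : ℕ :=
  ([91, 302, 345, 454, 650, 963].filter fun w => pairClass w p == k).length

/-- Data of the point `p` relative to the points `33, 504, 247`. -/
def profile (p : ℕ) : List ℕ :=
  [pairClass 33 p, pairClass 504 p, pairClass 247 p, cellCount 1 p, cellCount 2 p]

/-- The codes of points with a unique profile whose classes separate all points. -/
def base : List ℕ := [33, 35, 49, 69, 571, 963, 508, 285]

/-- The classes of the point `p` with respect to the points of `base`. -/
def baseClasses (p : ℕ) : ℕ := base.foldr (fun b s => 4 * s + pairClass b p) 0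

/-- Whether the values of `f` on the list are distinct and are not digit places of ones in `s`. -/
def distinctOn (f : ℕ → ℕ) : List ℕ → ℕ → Bool
  | [], _ => true
  | p :: l, s => !s.testBit (f p) && distinctOn f l (s ||| 2 ^ f p)

theorem cell_eq : cell = [91, 302, 345, 454, 650, 963] := by decide +kernel

theorem cell_nodup : cell.Nodup := by
  rw [cell_eq]
  decide

theorem base_subset_points : ∀ b ∈ base, b ∈ points := by decide +kernel

/-- Indistinguishable points have equal profiles, so this makes every point of `base` determined. -/
theorem profile_unique : ∀ b ∈ base, ∀ p ∈ points, profile p = profile b → p = b := by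
  decide +kernel

theorem distinctOn_baseClasses : distinctOn baseClasses points 0 = true := by decide +kernel

/-- The number `s` acts as a bit set of values already met, so a single pass tests injectivity. -/
theorem distinctOn_spec {f : ℕ → ℕ} {l : List ℕ} {s : ℕ} (h : distinctOn f l s = true) :
    (∀ p ∈ l, s.testBit (f p) = false) ∧ ∀ p ∈ l, ∀ r ∈ l, f p = f r → p = r := by
  induction l generalizing s with
  | nil => simp
  | cons a l ih =>
    rw [distinctOn, Bool.and_eq_true, Bool.not_eq_true'] at h
    obtain ⟨h1, h2⟩ := ih h.2
    have h3 : ∀ p ∈ l, s.testBit (f p) = false ∧ f a ≠ f p := by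
      intro p hp
      have := h1 p hp
      rwa [Nat.testBit_or, Bool.or_eq_false_iff, Nat.testBit_two_pow, decide_eq_false_iff_not]
        at this
    refine ⟨?_, ?_⟩
    · intro p hp
      rcases List.mem_cons.1 hp with rfl | hp
      · exact h.1
      · exact (h3 p hp).1
    · intro p hp r hr hpr
      rcases List.mem_cons.1 hp with hpa | hpl <;> rcases List.mem_cons.1 hr with hra | hrl
      · rw [hpa, hra]
      · exact absurd (hpa ▸ hpr) (h3 r hrl).2
      · exact absurd (hra ▸ hpr.symm) (h3 p hpl).2
      · exact h2 p hpl r hrl hpr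

/-! #### The encoding -/

theorem xor_lt {a b : ℕ} (ha : a < 32) (hb : b < 32) : a ^^^ b < 32 :=
  Nat.xor_lt_two_pow (n := 5) ha hb

/-- The number 37 is the code of `X⁵ + X² + 1`: the overflowing digit is returned to places 0 and 2.
-/
theorem mulX_spec : ∀ a < 32, mulX a < 32 ∧ mulX a % 2 = a / 16 % 2 ∧ mulX a / 2 % 2 = a % 2 ∧
    mulX a / 4 % 2 = (a / 2 % 2 + a / 16 % 2) % 2 ∧ mulX a / 8 % 2 = a / 4 % 2 ∧
    mulX a / 16 % 2 = a / 8 % 2 := by decide +kernel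

theorem mulStep_lt {a b i r : ℕ} (ha : a < 32) (hr : r < 32) : mulStep a b i r < 32 := by
  refine xor_lt (mulX_spec r hr).1 ?_
  change b / 2 ^ i % 2 * a < 32
  rcases Nat.mod_two_eq_zero_or_one (b / 2 ^ i) with h | h <;> rw [h] <;> omega

theorem mul_lt {a : ℕ} (b : ℕ) (ha : a < 32) : mul a b < 32 :=
  mulStep_lt ha (mulStep_lt ha (mulStep_lt ha (mulStep_lt ha (mulStep_lt ha (by norm_num)))))

theorem coordInv_lt {a c a' c' : ℕ} (ha : a < 32) (ha' : a' < 32) : coordInv a c a' c' < 32 :=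
  xor_lt (mul_lt _ (xor_lt (mul_lt _ ha) (mul_lt _ ha'))) (mul_lt _ (xor_lt ha ha'))

theorem exists_mul_eq_one : ∀ a < 32, a ≠ 0 → ∃ b < 32, mul a b = 1 := by decide +kernel

theorem isTraceZero_of_lt : ∀ y < 32, isTraceZero (mul y y ^^^ y) = true := by decide +kernel

theorem exists_of_isTraceZero : ∀ x < 32, isTraceZero x = true → ∃ y < 32, mul y y ^^^ y = x := by
  decide +kernel

/-- The three quintics are the minimal polynomials of the 15 nonzero elements of trace zero, five
for each. -/
theorem cls_eq : ∀ x < 32, cls x =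
    if mul (mul (mul x x) x) (mul x x) ^^^ mul x x ^^^ 1 = 0 then 1
    else if mul (mul (mul x x) x) (mul x x) ^^^ mul (mul x x) x ^^^ mul x x ^^^ x ^^^ 1 = 0 then 2
    else if mul (mul (mul x x) x) (mul x x) ^^^ mul (mul x x) x ^^^ 1 = 0 then 3 else 0 := by
  decide +kernel

section Decode

variable {K : Type*} [Field K] {θ : K}

/-- The field element with code `n`. -/
def decode (θ : K) (n : ℕ) : K :=
  (n % 2 : ℕ) + (n / 2 % 2 : ℕ) * θ + (n / 4 % 2 : ℕ) * θ ^ 2 + (n / 8 % 2 : ℕ) * θ ^ 3 +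
    (n / 16 % 2 : ℕ) * θ ^ 4

theorem decode_zero : decode θ 0 = 0 := by simp [decode]

theorem decode_one : decode θ 1 = 1 := by simp [decode]

variable [CharP K 2]

theorem cast_mod_two (n : ℕ) : ((n % 2 : ℕ) : K) = n := (CharP.cast_eq_mod K 2 n).symm

theorem decode_xor (θ : K) (a b : ℕ) : decode θ (a ^^^ b) = decode θ a + decode θ b := by
  have h : ∀ i, (((a ^^^ b) / 2 ^ i % 2 : ℕ) : K) = (a / 2 ^ i % 2 : ℕ) + (b / 2 ^ i % 2 : ℕ) := by
    intro i
    rw [Nat.xor_div_two_pow, Nat.xor_mod_two_eq, cast_mod_two, cast_mod_two, cast_mod_two,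
      Nat.cast_add]
  have h0 := h 0
  have h1 := h 1
  have h2 := h 2
  have h3 := h 3
  have h4 := h 4
  rw [pow_zero, Nat.div_one, Nat.div_one, Nat.div_one] at h0
  norm_num at h1 h2 h3 h4
  simp only [decode, h0, h1, h2, h3, h4]
  ring

theorem decode_mulX (hθ : θ ^ 5 = θ ^ 2 + 1) {a : ℕ} (ha : a < 32) :
    decode θ (mulX a) = θ * decode θ a := by
  obtain ⟨-, h0, h1, h2, h3, h4⟩ := mulX_spec a ha
  rw [decode, h0, h1, h2, h3, h4, decode, cast_mod_two (_ + _), Nat.cast_add]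
  linear_combination (-((a / 16 % 2 : ℕ) : K)) * hθ

theorem decode_mulStep (hθ : θ ^ 5 = θ ^ 2 + 1) (a b i : ℕ) {r : ℕ} (hr : r < 32) :
    decode θ (mulStep a b i r) = θ * decode θ r + (b / 2 ^ i % 2 : ℕ) * decode θ a := by
  change decode θ (mulX r ^^^ (b / 2 ^ i % 2 * a)) = _
  rw [decode_xor, decode_mulX hθ hr]
  rcases Nat.mod_two_eq_zero_or_one (b / 2 ^ i) with h | h <;> simp [h, decode_zero]

theorem decode_mul (hθ : θ ^ 5 = θ ^ 2 + 1) {a : ℕ} (ha : a < 32) (b : ℕ) :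
    decode θ (mul a b) = decode θ a * decode θ b := by
  have h0 : 0 < 32 := by norm_num
  have h4 := mulStep_lt (b := b) (i := 4) ha h0
  have h3 := mulStep_lt (b := b) (i := 3) ha h4
  have h2 := mulStep_lt (b := b) (i := 2) ha h3
  have h1 := mulStep_lt (b := b) (i := 1) ha h2
  rw [mul, decode_mulStep hθ _ _ _ h1, decode_mulStep hθ _ _ _ h2, decode_mulStep hθ _ _ _ h3,
    decode_mulStep hθ _ _ _ h4, decode_mulStep hθ _ _ _ h0, decode_zero]
  conv_rhs => rw [decode.eq_def θ b]
  norm_num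
  ring

/-- Nonzero codes have inverse codes, hence decode to units; irreducibility of the quintic is not
needed separately. -/
theorem decode_eq_zero_iff (hθ : θ ^ 5 = θ ^ 2 + 1) {a : ℕ} (ha : a < 32) :
    decode θ a = 0 ↔ a = 0 := by
  refine ⟨fun h => ?_, by rintro rfl; exact decode_zero⟩
  by_contra h0
  obtain ⟨b, -, hb⟩ := exists_mul_eq_one a ha h0
  have := decode_mul hθ ha b
  rw [hb, decode_one, h, zero_mul] at this
  exact one_ne_zero this

theorem decode_inj (hθ : θ ^ 5 = θ ^ 2 + 1) {a b : ℕ} (ha : a < 32) (hb : b < 32)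
    (h : decode θ a = decode θ b) : a = b := by
  rw [← Nat.xor_eq_zero_iff, ← decode_eq_zero_iff hθ (xor_lt ha hb), decode_xor, h]
  exact CharTwo.add_self_eq_zero _

theorem exists_generator [Finite K] (hK : Nat.card K = 2 ^ 5) : ∃ θ : K, θ ^ 5 = θ ^ 2 + 1 := by
  classical
  by_contra! hne
  have h2 : (2 : K) = 0 := CharTwo.two_eq_zero
  have := Fintype.ofFinite K
  -- This is the quotient of `X³² + X` by `X⁵ + X² + 1`. If the quintic had no zero, all 32 field
  -- elements would be roots of a nonzero polynomial of degree at most 27.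
  let p : Polynomial K := ∑ i ∈ ({1, 3, 5, 6, 7, 9, 10, 14, 15, 16, 17, 18, 21, 22, 24, 27} :
    Finset ℕ), Polynomial.X ^ i
  have hp : p.coeff 1 = 1 := by
    simp [p, Polynomial.coeff_X_pow]
  have hp0 : p ≠ 0 := by
    intro h
    simp [h] at hp
  have hdeg : p.natDegree ≤ 27 := by
    refine Polynomial.natDegree_sum_le_of_forall_le _ _ fun i hi => ?_
    rw [Polynomial.natDegree_X_pow]
    simp only [Finset.mem_insert, Finset.mem_singleton] at hi
    omega
  have hroot : ∀ x, p.IsRoot x := by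
    intro x
    have hx : x ^ 32 = x := by
      have := FiniteField.pow_card x
      rwa [← Nat.card_eq_fintype_card, hK] at this
    have h5 : x ^ 5 + x ^ 2 + 1 ≠ 0 := fun h => hne x (by grind)
    have hprod : (x ^ 5 + x ^ 2 + 1) * p.eval x = 0 := by
      have heval : p.eval x = x ^ 1 + x ^ 3 + x ^ 5 + x ^ 6 + x ^ 7 + x ^ 9 + x ^ 10 +
          x ^ 14 + x ^ 15 + x ^ 16 + x ^ 17 + x ^ 18 + x ^ 21 + x ^ 22 + x ^ 24 + x ^ 27 := by
        simp only [p, Polynomial.eval_finsetSum, Polynomial.eval_pow, Polynomial.eval_X]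
        norm_num
        ring
      rw [heval]
      linear_combination hx + (x ^ 3 + x ^ 5 + x ^ 6 + x ^ 7 + x ^ 8 + x ^ 9 + x ^ 10 + x ^ 11 +
        x ^ 12 + x ^ 14 + x ^ 15 + x ^ 16 + x ^ 17 + x ^ 18 + x ^ 19 + x ^ 20 + x ^ 21 +
        x ^ 22 + x ^ 23 + x ^ 24 + x ^ 26 + x ^ 27 + x ^ 29 + x) * h2
    exact (mul_eq_zero.1 hprod).resolve_left h5
  have hcard := Polynomial.card_roots' p
  have hsub : Finset.univ ⊆ p.roots.toFinset := fun x _ => by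
    rw [Multiset.mem_toFinset, Polynomial.mem_roots hp0]
    exact hroot x
  have h3 := Finset.card_le_card hsub
  have h4 := Multiset.toFinset_card_le p.roots
  rw [Finset.card_univ, ← Nat.card_eq_fintype_card, hK] at h3
  omega

end Decode

end GF32

/-! ### Encoding the points over the field of order 32 and separating them. -/

namespace GF32

variable {K : Type*} [Field K]

/-- The code of a field element. -/
noncomputable def encode (θ x : K) : ℕ := sInf {n | decode θ n = x}

/-- The code of a point. -/
noncomputable def code (θ : K) (P : HollmannPoint K) : ℕ := 32 * encode θ P.a + encode θ P.c

open Classical in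
/-- The class of conjugate elements of trace zero to which an element of the field of order `32`
belongs, described by minimal polynomials. -/
noncomputable def quinticClass (x : K) : ℕ :=
  if x ^ 5 + x ^ 2 + 1 = 0 then 1
  else if x ^ 5 + x ^ 3 + x ^ 2 + x + 1 = 0 then 2
  else if x ^ 5 + x ^ 3 + 1 = 0 then 3 else 0

theorem quinticClass_map (σ : K ≃+* K) (x : K) : quinticClass (σ x) = quinticClass x := by
  classical
  have h1 : σ x ^ 5 + σ x ^ 2 + 1 = 0 ↔ x ^ 5 + x ^ 2 + 1 = 0 := by
    rw [← map_eq_zero_iff σ σ.injective (x := x ^ 5 + x ^ 2 + 1)]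
    simp
  have h2 : σ x ^ 5 + σ x ^ 3 + σ x ^ 2 + σ x + 1 = 0 ↔ x ^ 5 + x ^ 3 + x ^ 2 + x + 1 = 0 := by
    rw [← map_eq_zero_iff σ σ.injective (x := x ^ 5 + x ^ 3 + x ^ 2 + x + 1)]
    simp
  have h3 : σ x ^ 5 + σ x ^ 3 + 1 = 0 ↔ x ^ 5 + x ^ 3 + 1 = 0 := by
    rw [← map_eq_zero_iff σ σ.injective (x := x ^ 5 + x ^ 3 + 1)]
    simp
  exact if_congr h1 rfl (if_congr h2 rfl (if_congr h3 rfl rfl))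

variable [CharP K 2] {θ : K}

theorem quinticClass_decode (hθ : θ ^ 5 = θ ^ 2 + 1) {n : ℕ} (hn : n < 32) :
    quinticClass (decode θ n) = cls n := by
  classical
  have hx2 := mul_lt n hn
  have hx3 := mul_lt n hx2
  have hx5 := mul_lt (mul n n) hx3
  have d2 : decode θ (mul n n) = decode θ n ^ 2 := by rw [decode_mul hθ hn, sq]
  have d3 : decode θ (mul (mul n n) n) = decode θ n ^ 3 := by
    rw [decode_mul hθ hx2, d2]
    ring
  have d5 : decode θ (mul (mul (mul n n) n) (mul n n)) = decode θ n ^ 5 := by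
    rw [decode_mul hθ hx3, d2, d3]
    ring
  have h1 : (1 : ℕ) < 32 := by norm_num
  rw [cls_eq n hn]
  refine if_congr ?_ rfl (if_congr ?_ rfl (if_congr ?_ rfl rfl))
  · rw [← decode_eq_zero_iff hθ (xor_lt (xor_lt hx5 hx2) h1), decode_xor, decode_xor, d2, d5,
      decode_one]
  · rw [← decode_eq_zero_iff hθ (xor_lt (xor_lt (xor_lt (xor_lt hx5 hx3) hx2) hn) h1), decode_xor,
      decode_xor, decode_xor, decode_xor, d2, d3, d5, decode_one]
  · rw [← decode_eq_zero_iff hθ (xor_lt (xor_lt hx5 hx3) h1), decode_xor, decode_xor, d3, d5,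
      decode_one]

theorem mem_points_of_mem_cell {p : ℕ} (hp : p ∈ cell) : p ∈ points := by
  rw [cell, List.mem_filter] at hp
  exact hp.1

theorem mem_points_iff {p : ℕ} :
    p ∈ points ↔ p < 1024 ∧ isTraceZero (mul (p / 32) (p % 32)) = false := by
  simp [points]

theorem isTraceZero_iff (hθ : θ ^ 5 = θ ^ 2 + 1)
    (hsurj : ∀ x, ∃ n < 32, decode θ n = x) {n : ℕ} (hn : n < 32) :
    isTraceZero n = true ↔ decode θ n ∈ (artinSchreier K).range := by
  constructor
  · intro h
    obtain ⟨y, hy, rfl⟩ := exists_of_isTraceZero n hn h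
    refine ⟨decode θ y, ?_⟩
    rw [artinSchreier_apply, decode_xor, decode_mul hθ hy, sq]
  · rintro ⟨y, hy⟩
    obtain ⟨m, hm, rfl⟩ := hsurj y
    have h : mul m m ^^^ m = n := by
      refine decode_inj hθ (xor_lt (mul_lt m hm) hm) hn ?_
      rw [decode_xor, decode_mul hθ hm, ← hy, artinSchreier_apply, sq]
    rw [← h]
    exact isTraceZero_of_lt m hm

variable [Finite K]

theorem exists_decode_eq (hθ : θ ^ 5 = θ ^ 2 + 1) (hK : Nat.card K = 2 ^ 5) (x : K) :
    ∃ n < 32, decode θ n = x := by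
  have hinj : Function.Injective fun i : Fin 32 => decode θ i := fun i j h =>
    Fin.ext (decode_inj hθ i.2 j.2 h)
  have hbij := (Nat.bijective_iff_injective_and_card _).2 ⟨hinj, by rw [hK]; simp⟩
  obtain ⟨i, hi⟩ := hbij.2 x
  exact ⟨i, i.2, hi⟩

theorem decode_encode (hθ : θ ^ 5 = θ ^ 2 + 1) (hK : Nat.card K = 2 ^ 5) (x : K) :
    decode θ (encode θ x) = x := by
  obtain ⟨n, -, hn⟩ := exists_decode_eq hθ hK x
  exact Nat.sInf_mem (s := {n | decode θ n = x}) ⟨n, hn⟩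

theorem encode_lt (hθ : θ ^ 5 = θ ^ 2 + 1) (hK : Nat.card K = 2 ^ 5) (x : K) :
    encode θ x < 32 := by
  obtain ⟨n, hn, hx⟩ := exists_decode_eq hθ hK x
  exact lt_of_le_of_lt (Nat.sInf_le hx) hn

theorem encode_decode (hθ : θ ^ 5 = θ ^ 2 + 1) (hK : Nat.card K = 2 ^ 5) {n : ℕ} (hn : n < 32) :
    encode θ (decode θ n) = n :=
  decode_inj hθ (encode_lt hθ hK _) hn (decode_encode hθ hK _)

theorem code_div (hθ : θ ^ 5 = θ ^ 2 + 1) (hK : Nat.card K = 2 ^ 5) (P : HollmannPoint K) :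
    code θ P / 32 = encode θ P.a := by
  have := encode_lt hθ hK P.c
  rw [code]
  omega

theorem code_mod (hθ : θ ^ 5 = θ ^ 2 + 1) (hK : Nat.card K = 2 ^ 5) (P : HollmannPoint K) :
    code θ P % 32 = encode θ P.c := by
  have := encode_lt hθ hK P.c
  rw [code]
  omega

theorem code_injective (hθ : θ ^ 5 = θ ^ 2 + 1) (hK : Nat.card K = 2 ^ 5) :
    Function.Injective (code θ) := by
  intro P R h
  refine HollmannPoint.ext_coord ?_ ?_
  · rw [← decode_encode hθ hK P.a, ← code_div hθ hK, h, code_div hθ hK, decode_encode hθ hK]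
  · rw [← decode_encode hθ hK P.c, ← code_mod hθ hK, h, code_mod hθ hK, decode_encode hθ hK]

theorem code_mem_points (hθ : θ ^ 5 = θ ^ 2 + 1) (hK : Nat.card K = 2 ^ 5)
    (P : HollmannPoint K) : code θ P ∈ points := by
  have ha := encode_lt hθ hK P.a
  have hc := encode_lt hθ hK P.c
  rw [mem_points_iff, code_div hθ hK, code_mod hθ hK, ← Bool.not_eq_true,
    isTraceZero_iff hθ (exists_decode_eq hθ hK) (mul_lt _ ha), decode_mul hθ ha,
    decode_encode hθ hK, decode_encode hθ hK]
  refine ⟨?_, P.mul_notMem_range⟩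
  rw [code]
  omega

theorem exists_code_eq (hθ : θ ^ 5 = θ ^ 2 + 1) (hK : Nat.card K = 2 ^ 5) {p : ℕ}
    (hp : p ∈ points) : ∃ P : HollmannPoint K, code θ P = p := by
  rw [mem_points_iff, ← Bool.not_eq_true] at hp
  have ha : p / 32 < 32 := by omega
  have hc : p % 32 < 32 := by omega
  rw [isTraceZero_iff hθ (exists_decode_eq hθ hK) (mul_lt _ ha), decode_mul hθ ha] at hp
  obtain ⟨P, hPa, hPc⟩ := HollmannPoint.exists_coord_of_notMem hp.2
  refine ⟨P, ?_⟩
  rw [code, hPa, hPc, encode_decode hθ hK ha, encode_decode hθ hK hc]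
  omega

theorem quinticClass_inv (hθ : θ ^ 5 = θ ^ 2 + 1) (hK : Nat.card K = 2 ^ 5)
    (P R : HollmannPoint K) : quinticClass (P.inv R) = pairClass (code θ P) (code θ R) := by
  have hPa := encode_lt hθ hK P.a
  have hRa := encode_lt hθ hK R.a
  have h : P.inv R =
      decode θ (coordInv (encode θ P.a) (encode θ P.c) (encode θ R.a) (encode θ R.c)) := by
    change _ = decode θ
      (mul (mul _ _ ^^^ mul _ _) (mul _ _ ^^^ mul _ _) ^^^ mul (_ ^^^ _) (_ ^^^ _))
    rw [decode_xor, decode_mul hθ (xor_lt (mul_lt _ hPa) (mul_lt _ hRa)),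
      decode_mul hθ (xor_lt hPa hRa), decode_xor, decode_xor, decode_xor, decode_mul hθ hPa,
      decode_mul hθ hRa]
    simp only [decode_encode hθ hK]
    rw [HollmannPoint.inv, sq]
  rw [h, quinticClass_decode hθ (coordInv_lt hPa hRa)]
  change _ = cls (coordInv (_ / 32) (_ % 32) (_ / 32) (_ % 32))
  rw [code_div hθ hK, code_div hθ hK, code_mod hθ hK, code_mod hθ hK]

/-- Field automorphisms preserve minimal polynomials, so the class is constant on orbits of pairs.
-/
theorem class_mem_relations (k : ℕ) :
    {p : HollmannPoint K × HollmannPoint K | quinticClass (p.1.inv p.2) = k} ∈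
      (smallHollmannScheme K).relations := by
  rw [CoherentConfiguration.mem_relations_iff]
  rintro ⟨P, R⟩ ⟨P', R'⟩ h hk
  obtain ⟨σ, hσ⟩ := HollmannPoint.exists_inv_eq_of_toSetoid h
  change quinticClass (P'.inv R') = k
  rw [hσ, quinticClass_map]
  exact hk

open CoherentConfiguration

/-- For degree five, some three points determine all points in the `3`-extension. -/
theorem exists_determined (hK : Nat.card K = 2 ^ 5) :
    ∃ α β γ : HollmannPoint K, ∀ δ, (smallHollmannScheme K).Determined α β γ δ := by
  obtain ⟨θ, hθ⟩ := exists_generator hK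
  obtain ⟨α, hα⟩ := exists_code_eq hθ hK (p := 33) (by decide +kernel)
  obtain ⟨β, hβ⟩ := exists_code_eq hθ hK (p := 504) (by decide +kernel)
  obtain ⟨γ, hγ⟩ := exists_code_eq hθ hK (p := 247) (by decide +kernel)
  refine ⟨α, β, γ, ?_⟩
  set X := smallHollmannScheme K
  have hclass : ∀ {δ δ' w : HollmannPoint K}, X.Indist α β γ δ δ' → X.Determined α β γ w →
      pairClass (code θ w) (code θ δ) = pairClass (code θ w) (code θ δ') := by
    intro δ δ' w h hw
    rw [← quinticClass_inv hθ hK, ← quinticClass_inv hθ hK]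
    exact ((X.mem_iff_of_toSetoid (class_mem_relations _) (h.toSetoid_of_determined hw)).1
      (rfl : quinticClass (w.inv δ) = _)).symm
  have hαc : ∀ {δ δ'}, X.Indist α β γ δ δ' →
      pairClass 33 (code θ δ) = pairClass 33 (code θ δ') := fun h => hα ▸ hclass h determined_fst
  have hβc : ∀ {δ δ'}, X.Indist α β γ δ δ' →
      pairClass 504 (code θ δ) = pairClass 504 (code θ δ') := fun h => hβ ▸ hclass h determined_snd
  have hγc : ∀ {δ δ'}, X.Indist α β γ δ δ' →
      pairClass 247 (code θ δ) = pairClass 247 (code θ δ') := fun h => hγ ▸ hclass h determined_trd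
  have hcount : ∀ (k : ℕ) (δ : HollmannPoint K),
      {w | w ∈ {w | code θ w ∈ cell} ∧
        (w, δ) ∈ {p : HollmannPoint K × HollmannPoint K | quinticClass (p.1.inv p.2) = k}}.ncard =
      cellCount k (code θ δ) := by
    intro k δ
    rw [← Set.ncard_image_of_injective _ (code_injective hθ hK), cellCount, ← cell_eq,
      ← List.toFinset_card_of_nodup (cell_nodup.filter _),
      ← Set.ncard_coe_finset]
    congr 1
    ext p
    simp only [Set.mem_image, List.coe_toFinset, List.mem_filter, beq_iff_eq]
    constructor
    · rintro ⟨w, ⟨hw, hwδ⟩, rfl⟩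
      exact ⟨hw, (quinticClass_inv hθ hK w δ).symm.trans hwδ⟩
    · rintro ⟨hp, hpk⟩
      obtain ⟨w, rfl⟩ := exists_code_eq hθ hK (mem_points_of_mem_cell hp)
      exact ⟨w, ⟨hp, (quinticClass_inv hθ hK w δ).trans hpk⟩, rfl⟩
  -- The cell is cut out by classes with respect to the three determined points, so it is closed
  -- under indistinguishability and neighbour counts over it are invariants.
  have hcell : ∀ w ∈ {w | code θ w ∈ cell}, ∀ w', X.Indist α β γ w w' →
      w' ∈ {w | code θ w ∈ cell} := by
    intro w hw w' h
    have hw1 : code θ w ∈ cell := hw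
    change code θ w' ∈ cell
    rw [cell, List.mem_filter] at hw1 ⊢
    rw [← hαc h, ← hβc h, ← hγc h]
    exact ⟨code_mem_points hθ hK w', hw1.2⟩
  have hprofile : ∀ {δ δ'}, X.Indist α β γ δ δ' →
      profile (code θ δ) = profile (code θ δ') := by
    intro δ δ' h
    have hk : ∀ k, cellCount k (code θ δ) = cellCount k (code θ δ') := fun k => by
      rw [← hcount, ← hcount]
      exact h.ncard_eq hcell (class_mem_relations k)
    rw [profile, profile, hαc h, hβc h, hγc h, hk, hk]
  -- Points of `base` are determined by their profiles, so they may be used as further reference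
  -- points.
  have hbase : ∀ b ∈ base, ∀ {δ δ'}, X.Indist α β γ δ δ' →
      pairClass b (code θ δ) = pairClass b (code θ δ') := by
    intro b hb δ δ' h
    have hbp : b ∈ points := base_subset_points b hb
    obtain ⟨B, rfl⟩ := exists_code_eq hθ hK hbp
    refine hclass h fun B' hB' => code_injective hθ hK ?_
    exact (profile_unique _ hb _ (code_mem_points hθ hK B') (hprofile hB').symm).symm
  intro δ δ' h
  refine code_injective hθ hK ((distinctOn_spec distinctOn_baseClasses).2 _
    (code_mem_points hθ hK δ) _ (code_mem_points hθ hK δ') ?_)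
  exact List.foldr_ext _ _ _ fun b hb s => by rw [hbase b hb h]

end GF32

theorem eq_three_or_five_or_le {d : ℕ} (hd : d.Prime) (hd3 : 3 ≤ d) (hd7 : d ≠ 7)
    (hd11 : d ≠ 11) (hd13 : d ≠ 13) : d = 3 ∨ d = 5 ∨ 17 ≤ d := by
  by_contra! h
  have h17 := h.2.2
  interval_cases d <;> revert hd <;> first | omega | decide

theorem theorem1p3 (d : ℕ) (hd : d.Prime) (hd3 : 3 ≤ d)
    (hd7 : d ≠ 7) (hd11 : d ≠ 11) (hd13 : d ≠ 13)
    (K : Type*) [Field K] [Finite K] (hK : Nat.card K = 2 ^ d) :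
    (smallHollmannScheme K).separabilityNumber ≤ 3 ∧
      (smallHollmannScheme K).IsDeterminedBy 3 := by
  have := charP_two_of_card hK
  have main : (smallHollmannScheme K).IsDeterminedBy 3 := by
    rcases eq_three_or_five_or_le hd hd3 hd7 hd11 hd13 with rfl | rfl | hd17
    · exact HollmannPoint.isDeterminedBy_of_card_eight hK
    · obtain ⟨α, β, γ, h⟩ := GF32.exists_determined hK
      exact fun Ω' _ X' φ hφ => CoherentConfiguration.exists_isInducedBy_of_determined h φ hφ
    · obtain ⟨α, β, γ, h⟩ := HollmannPoint.exists_determined hd hK hd17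
      exact fun Ω' _ X' φ hφ => CoherentConfiguration.exists_isInducedBy_of_determined h φ hφ
  exact ⟨sInf_le ⟨3, by norm_num, main, rfl⟩, main⟩
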